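/- Let $\tfrac12<\beta<1$. For $r>0$ consider testing, from $n$ i.i.d. observations $X_1,\dots,X_n$, $$H_0:\ X_i\sim \mathrm{Exp}(2)\qquad\text{against}\qquad H_1^{(n)}:\ X_i\sim (1-\varepsilon_n)\,\mathrm{Exp}(2)+\varepsilon_n\,\chi^2_2(\delta_n),\qquad \varepsilon_n=n^{-\beta},\quad \delta_n=2r\log n ,$$ where $\mathrm{Exp}(2)$ is the exponential distribution with mean $2$ and $\chi^2_2(\delta)$ is the noncentral chi-squared distribution with $2$ degrees of freedom and noncentrality parameter $\delta$ (the law of $Y^2+Z^2$ for independent $Y\sim N(\sqrt\delta,1)$, $Z\sim N(0,1)$). Let $p_i=\mathrm{Prob}\{\mathrm{Exp}(2)>X_i\}$, with order statistics $p_{(1)}\le\dots\le p_{(n)}$, fix $\alpha_0\in(0,1)$, and let $$\mathrm{HC}^*_n=\max_{1\le i\le \alpha_0 n}\frac{\sqrt n\,\bigl(i/n-p_{(i)}\bigr)}{\sqrt{p_{(i)}(1-p_{(i)})}} .$$ The higher criticism test with critical value $h_n$ rejects $H_0$ when $\mathrm{HC}^*_n>h_n$. Levels $\alpha_n\to0$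 with critical values $h_n$ (so $P_{H_0}\{\mathrm{HC}^*_n>h_n\}\le\alpha_n$ for all large $n$) are said to tend to $0$ slowly enough if $h_n=\sqrt{2\log\log n}\,(1+o(1))$. The higher criticism detection boundary $\rho_{\mathrm{HC,Exp}}(\beta)$ is the number $\rho$ such that, for all levels tending to $0$ slowly enough, with corresponding critical values $h_n$, and all $r>0$, $$P_{H_1^{(n)}}\{\mathrm{HC}^*_n>h_n\}\to 1\ \text{ if } r>\rho,\qquad P_{H_1^{(n)}}\{\mathrm{HC}^*_n>h_n\}\to 0\ \text{ if } r<\rho .$$ The intrinsic detection boundary $\rho^*_{\mathrm{Exp}}(\beta)$ is the number $\rho$ such that, for all $r>0$, the smallest possible sum of the Type I and Type II error probabilities of a test of $H_0$ against $H_1^{(n)}$ (attained by the likelihood ratio test) tends to $0$ if $r>\rho$ (the hypotheses separate asymptotically) and to $1$ if $r<\rho$ (they merge asymptotically). Then both boundaries exist, each is the only number with its defining property (for every choice of $\alpha_0\in(0,1)$), and they equal the detection boundary of the corresponding Gaussian model: $$\rho_{\mathrm{HC,Exp}}(\beta)=\rho^*_{\mathrm{Exp}}(\beta)=\rho^*(\beta)=\begin{cases}\beta-\tfrac12,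 & \tfrac12<\beta\le\tfrac34,\\[2pt] (1-\sqrt{1-\beta})^2, & \tfrac34<\beta<1.\end{cases}$$ -/

import Mathlib

open MeasureTheory ProbabilityTheory Filter Topology

noncomputable section

namespace HigherCriticism

/-- `Exp(2)`: the exponential distribution with mean `2`, that is, with rate `1 / 2`. -/
def exp2 : Measure ℝ := expMeasure (1 / 2)

/-- `χ²₂(δ)`: the noncentral chi-squared distribution with two degrees of freedom and
noncentrality parameter `δ ≥ 0`, the law of `Y² + Z²` for independent `Y ∼ N(√δ, 1)` and
`Z ∼ N(0, 1)`. -/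
def noncentralChiSq2 (δ : ℝ) : Measure ℝ :=
  ((gaussianReal (√δ) 1).prod (gaussianReal 0 1)).map (fun z : ℝ × ℝ => z.1 ^ 2 + z.2 ^ 2)

/-- The mixture `(1 - ε) Exp(2) + ε χ²₂(δ)`, for `0 ≤ ε ≤ 1`. -/
def mixture (ε δ : ℝ) : Measure ℝ :=
  ENNReal.ofReal (1 - ε) • exp2 + ENNReal.ofReal ε • noncentralChiSq2 δ

/-- Law of the sample `(X₁, …, Xₙ)` under the null hypothesis `H₀`: i.i.d. `Exp(2)`. -/
def nullLaw (n : ℕ) : Measure (Fin n → ℝ) := Measure.pi fun _ => exp2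

/-- Law of the sample `(X₁, …, Xₙ)` under the alternative `H₁⁽ⁿ⁾` with parameters `β` and `r`:
i.i.d. `(1 - εₙ) Exp(2) + εₙ χ²₂(δₙ)` with `εₙ = n ^ (-β)` and `δₙ = 2 r log n`. -/
def altLaw (β r : ℝ) (n : ℕ) : Measure (Fin n → ℝ) :=
  Measure.pi fun _ => mixture ((n : ℝ) ^ (-β)) (2 * r * Real.log n)

/-- The `p`-value `Prob{Exp(2) > x}` of an observation `x`. -/
def pValue (x : ℝ) : ℝ := exp2.real (Set.Ioi x)

/-- The order statistic `p₍ᵢ₊₁₎` (the indices of `Fin n` start at `0`). -/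
def orderStat {n : ℕ} (p : Fin n → ℝ) (i : Fin n) : ℝ := p (Tuple.sort p i)

/-- The higher criticism statistic
`HC*ₙ = max_{1 ≤ i ≤ α₀ n} √n (i / n - p₍ᵢ₎) / √(p₍ᵢ₎ (1 - p₍ᵢ₎))` of the `p`-values `p`.
The maximum is over a finite set, which is nonempty as soon as `α₀ n ≥ 1`. -/
def hcStat (α₀ : ℝ) {n : ℕ} (p : Fin n → ℝ) : ℝ :=
  ⨆ i : {i : Fin n // ((i : ℕ) : ℝ) + 1 ≤ α₀ * n},
    √(n : ℝ) * ((((i : Fin n) : ℕ) + 1 : ℝ) / n - orderStat p i) /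
      √(orderStat p i * (1 - orderStat p i))

/-- The event that the higher criticism test with critical value `h` rejects `H₀`, that is,
that `HC*ₙ > h`. -/
def hcReject (α₀ : ℝ) (n : ℕ) (h : ℝ) : Set (Fin n → ℝ) :=
  {x | h < hcStat α₀ (fun i => pValue (x i))}

/-- `α n` are levels that tend to `0` slowly enough, and `h n = h(n, α n)` are corresponding
critical values: `P_{H₀}(HC*ₙ > h n) ≤ α n` for all large `n`, `α n → 0`, and
`h n = √(2 log log n) (1 + o(1))`. -/
structure SlowLevels (α₀ : ℝ) (α h : ℕ → ℝ) : Prop where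
  level : ∀ᶠ n in atTop, (nullLaw n).real (hcReject α₀ n (h n)) ≤ α n
  tendsto_zero : Tendsto α atTop (𝓝 0)
  slow : Tendsto (fun n : ℕ => h n / √(2 * Real.log (Real.log n))) atTop (𝓝 1)

/-- `ρ` has the property that defines the detection boundary of higher criticism at sparsity
`β`: whenever the levels tend to `0` slowly enough, the power of the test tends to `1` if
`r > ρ` and to `0` if `r < ρ`. -/
def IsHCDetectionBoundary (α₀ β ρ : ℝ) : Prop :=
  ∀ α h : ℕ → ℝ, SlowLevels α₀ α h → ∀ r : ℝ, 0 < r →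
    (ρ < r → Tendsto (fun n => (altLaw β r n).real (hcReject α₀ n (h n))) atTop (𝓝 1)) ∧
    (r < ρ → Tendsto (fun n => (altLaw β r n).real (hcReject α₀ n (h n))) atTop (𝓝 0))

/-- The least sum of the Type I and Type II errors among all tests of `P` against `Q`; a test is
given by its (measurable) rejection region `R`. The likelihood ratio test attains it. -/
def minTotalError {Ω : Type*} [MeasurableSpace Ω] (P Q : Measure Ω) : ℝ :=
  ⨅ R : {R : Set Ω // MeasurableSet R}, (P.real (R : Set Ω) + Q.real (R : Set Ω)ᶜ)

/-- `H₀` and `H₁⁽ⁿ⁾` separate asymptotically: the optimal sum of errors tends to `0`. -/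
def Separate (β r : ℝ) : Prop :=
  Tendsto (fun n => minTotalError (nullLaw n) (altLaw β r n)) atTop (𝓝 0)

/-- `H₀` and `H₁⁽ⁿ⁾` merge asymptotically: the optimal sum of errors tends to `1`. -/
def Merge (β r : ℝ) : Prop :=
  Tendsto (fun n => minTotalError (nullLaw n) (altLaw β r n)) atTop (𝓝 1)

/-- `ρ` has the property that defines the intrinsic detection boundary at sparsity `β`: the
hypotheses separate asymptotically if `r > ρ` and merge asymptotically if `r < ρ`. -/
def IsIntrinsicDetectionBoundary (β ρ : ℝ) : Prop :=
  ∀ r : ℝ, 0 < r → (ρ < r → Separate β r) ∧ (r < ρ → Merge β r)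

/-- The detection boundary `ρ*(β)` of the Gaussian model, `1 / 2 < β < 1`. -/
def rhoStar (β : ℝ) : ℝ :=
  if β ≤ 3 / 4 then β - 1 / 2 else (1 - √(1 - β)) ^ 2

end HigherCriticism

end

/-! An observation is the squared norm of a planar Gaussian vector `(Y, Z)`, centred under the null
and shifted by `√δ` in the first coordinate with probability `ε`. With `T = √(2 log n)` the shift is
`√r T`, so all relevant probabilities are powers of `n`, and the boundary comes from comparing
exponents.

Below the boundary, passing to squared norms cannot reduce the testing error, so it is enough that
the Gaussian pairs merge (`le_minTotalError_laws`). There the likelihood ratio is truncated to `Y ≤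
T` and its second moment is computed (`minTotalError_pi_ge`). The truncated second moment stays
harmless when `r < β - 1/2` or, for `r ≥ 1/4`, when `1 - β < (1 - √r)²`; the mass lost is negligible
under the latter condition (`merge_of_lt_rhoStar`). Higher criticism with vanishing level then has
vanishing power, like any other test.

Above the boundary a single level suffices: at `t = n^(-q)` with `q = min (4r) 1`, the number of
`p`-values below `t` exceeds its null mean by a power of `n` times its null standard deviation.
Since `Y² + Z² ≥ Y²`, a one-dimensional Gaussian tail bounds the excess from below, and Chebyshev's
inequality concludes (`tendsto_hcReject_of_rhoStar_lt`).

The boundary of higher criticism is unique only if some levels do tend to zero slowly enough;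
otherwise its defining property is vacuous. Hence the hard fact about the null: for every `θ > 1`
the critical value `√(2θ log log n)` has vanishing level (`tendsto_nullLaw_hcReject`). The counting
process of uniform variables carries an exponential reverse martingale. Its maximal inequality is
applied on geometric blocks: about `log n` blocks, each crossed with probability about `(log
n)^(-γ)`, `γ > 1`, up to a summable error. A diagonal choice of `θ` gives `exists_slowLevels`, which
also makes higher criticism a separating test. -/

namespace HigherCriticism

/-! ### Densities of product measures. -/

section ProductMeasures

variable {Ω : Type*} [MeasurableSpace Ω]

lemma lintegral_pi_prod {n : ℕ} (P : Measure Ω) [IsProbabilityMeasure P]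
    (f : Fin n → Ω → ENNReal) (hf : ∀ i, Measurable (f i)) :
    ∫⁻ x, ∏ i, f i (x i) ∂(Measure.pi fun _ : Fin n => P) = ∏ i, ∫⁻ y, f i y ∂P := by
  have h := lintegral_prod_eq_prod_lintegral_of_indepFun Finset.univ
    (fun (i : Fin n) (x : Fin n → Ω) => f i (x i))
    (iIndepFun_pi (μ := fun _ : Fin n => P) fun i => (hf i).aemeasurable)
    (fun i => (hf i).comp (measurable_pi_apply i))
  rw [h]
  refine Finset.prod_congr rfl fun i _ => ?_
  exact (measurePreserving_eval (fun _ : Fin n => P) i).lintegral_comp (hf i)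

lemma pi_withDensity {n : ℕ} (P : Measure Ω) [IsProbabilityMeasure P]
    (f : Ω → ENNReal) (hf : Measurable f) [IsFiniteMeasure (P.withDensity f)] :
    (Measure.pi fun _ : Fin n => P.withDensity f) =
      (Measure.pi fun _ => P).withDensity (fun x => ∏ i, f (x i)) := by
  refine Measure.pi_eq fun s hs => ?_
  rw [withDensity_apply _ (MeasurableSet.univ_pi hs), ← lintegral_indicator
    (MeasurableSet.univ_pi hs)]
  have : ∀ x : Fin n → Ω, (Set.univ.pi s).indicator (fun x => ∏ i, f (x i)) x =
      ∏ i, (s i).indicator f (x i) := by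
    intro x
    by_cases hx : x ∈ Set.univ.pi s
    · rw [Set.indicator_of_mem hx]
      exact Finset.prod_congr rfl fun i _ => (Set.indicator_of_mem (hx i trivial) _).symm
    · rw [Set.indicator_of_notMem hx]
      simp only [Set.mem_univ_pi, not_forall] at hx
      obtain ⟨i, hi⟩ := hx
      exact (Finset.prod_eq_zero (Finset.mem_univ i) (Set.indicator_of_notMem hi _)).symm
  simp_rw [this]
  rw [lintegral_pi_prod P (fun i => (s i).indicator f) fun i => hf.indicator (hs i)]
  refine Finset.prod_congr rfl fun i _ => ?_
  rw [lintegral_indicator (hs i), withDensity_apply _ (hs i)]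

lemma one_sub_mul_le_pow {κ : ℝ} (h1 : κ ≤ 1) (n : ℕ) : 1 - n * κ ≤ (1 - κ) ^ n := by
  have := one_add_mul_le_pow (a := -κ) (by linarith) n
  calc 1 - n * κ = 1 + n * -κ := by ring
    _ ≤ (1 + -κ) ^ n := this
    _ = (1 - κ) ^ n := by ring

end ProductMeasures

/-! ### The optimal total error and its second-moment lower bound. -/

section TotalError

variable {Ω : Type*} [MeasurableSpace Ω]

lemma bddBelow_totalError (P Q : Measure Ω) :
    BddBelow (Set.range fun R : {R : Set Ω // MeasurableSet R} =>
      P.real (R : Set Ω) + Q.real (R : Set Ω)ᶜ) :=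
  ⟨0, by rintro _ ⟨R, rfl⟩; positivity⟩

lemma minTotalError_le (P Q : Measure Ω) {R : Set Ω} (hR : MeasurableSet R) :
    minTotalError P Q ≤ P.real R + Q.real Rᶜ :=
  ciInf_le (bddBelow_totalError P Q) ⟨R, hR⟩

instance : Nonempty {R : Set Ω // MeasurableSet R} := ⟨⟨∅, MeasurableSet.empty⟩⟩

lemma le_minTotalError {P Q : Measure Ω} {c : ℝ}
    (h : ∀ R, MeasurableSet R → c ≤ P.real R + Q.real Rᶜ) : c ≤ minTotalError P Q :=
  le_ciInf fun R => h R R.2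

lemma minTotalError_nonneg (P Q : Measure Ω) : 0 ≤ minTotalError P Q :=
  le_minTotalError fun _ _ => by positivity

lemma minTotalError_le_one (P Q : Measure Ω) [IsProbabilityMeasure Q] :
    minTotalError P Q ≤ 1 := by
  simpa using minTotalError_le P Q MeasurableSet.empty

/-- A test of the images pulls back to a test of the originals with the same errors. -/
lemma minTotalError_map {Ω' : Type*} [MeasurableSpace Ω'] (P Q : Measure Ω) {T : Ω → Ω'}
    (hT : Measurable T) : minTotalError P Q ≤ minTotalError (P.map T) (Q.map T) := by
  refine le_minTotalError fun R hR => ?_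
  rw [map_measureReal_apply hT hR, map_measureReal_apply hT hR.compl]
  exact minTotalError_le P Q (hT hR)

/-- A set that is unlikely under `P` is unlikely under `Q` when the two laws merge. -/
lemma measureReal_le_of_minTotalError (P Q : Measure Ω) [IsProbabilityMeasure P]
    [IsProbabilityMeasure Q] (A : Set Ω) :
    Q.real A ≤ P.real A + (1 - minTotalError P Q) := by
  -- `A` need not be measurable, so the test rejects on a measurable hull with the same `P`-measure.
  have hm := measurableSet_toMeasurable P A
  have h := minTotalError_le P Q hm
  have h1 : P.real (toMeasurable P A) = P.real A := by
    simp [Measure.real, measure_toMeasurable]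
  have h2 : Q.real A ≤ Q.real (toMeasurable P A) :=
    measureReal_mono (subset_toMeasurable P A)
  have h3 := probReal_compl_eq_one_sub (μ := Q) hm
  linarith

/-- A lower bound of the total error for testing `Pⁿ` against the mixture
`((1 - ε) P + ε Q)ⁿ`, by the second moment of the likelihood ratio `g` truncated to `A`. -/
lemma minTotalError_pi_ge {P Q : Measure Ω} [IsProbabilityMeasure P] [IsProbabilityMeasure Q]
    {g : Ω → ℝ} (hg : Measurable g) (hg0 : ∀ x, 0 ≤ g x)
    (hQ : Q = P.withDensity fun x => ENNReal.ofReal (g x))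
    {A : Set Ω} (hA : MeasurableSet A) {ε G κ : ℝ} (hε0 : 0 ≤ ε) (hε1 : ε ≤ 1)
    (hgi : IntegrableOn (fun x => g x ^ 2) A P) (hG : ∫ x in A, g x ^ 2 ∂P ≤ G)
    (hκ : ε * Q.real Aᶜ ≤ κ) (n : ℕ) :
    1 - √(Real.exp (n * (ε ^ 2 * G)) - 1 + 2 * (n * κ)) ≤
      minTotalError (Measure.pi fun _ : Fin n => P)
        (Measure.pi fun _ : Fin n => ENNReal.ofReal (1 - ε) • P + ENNReal.ofReal ε • Q) := by
  set Pn := Measure.pi fun _ : Fin n => P with hPn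
  -- The mixture density truncated to `A`: it has finite second moment and loses only the mass `ε *
  -- Q.real Aᶜ`.
  set f : Ω → ℝ := fun x => (1 - ε) + ε * A.indicator g x with hf
  have hind0 : ∀ x, 0 ≤ A.indicator g x := fun x => Set.indicator_nonneg (fun x _ => hg0 x) x
  have hfm : Measurable f := by
    have := hg.indicator hA
    fun_prop
  have hf0 : ∀ x, 0 ≤ f x := fun x =>
    add_nonneg (by linarith) (mul_nonneg hε0 (hind0 x))
  have hgi1 : Integrable g P := by
    refine ⟨hg.aestronglyMeasurable, ?_⟩
    rw [hasFiniteIntegral_iff_ofReal (ae_of_all _ hg0)]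
    have : ∫⁻ x, ENNReal.ofReal (g x) ∂P = Q Set.univ := by
      rw [hQ, withDensity_apply _ MeasurableSet.univ, Measure.restrict_univ]
    rw [this]; exact measure_lt_top _ _
  have hQA : ∀ B, MeasurableSet B → Q.real B = ∫ x in B, g x ∂P := by
    intro B hB
    rw [Measure.real, hQ, withDensity_apply _ hB,
      integral_eq_lintegral_of_nonneg_ae (ae_of_all _ hg0) hg.aestronglyMeasurable]
  have hiA : Integrable (A.indicator g) P := hgi1.indicator hA
  have hiA2 : Integrable (fun x => A.indicator g x ^ 2) P := by
    have : (fun x => A.indicator g x ^ 2) = A.indicator (fun x => g x ^ 2) := by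
      ext x; by_cases hx : x ∈ A <;> simp [hx]
    rw [this]; exact hgi.integrable_indicator hA
  have hIA2 : ∫ x, A.indicator g x ^ 2 ∂P ≤ G := by
    have : (fun x => A.indicator g x ^ 2) = A.indicator (fun x => g x ^ 2) := by
      ext x; by_cases hx : x ∈ A <;> simp [hx]
    rw [this, integral_indicator hA]; exact hG
  have hIA : ∫ x, A.indicator g x ∂P = Q.real A := by
    rw [integral_indicator hA, hQA A hA]
  have hfi : Integrable f P := (integrable_const _).add (hiA.const_mul _)
  have hf2 : (fun x => f x ^ 2) = fun x => (1 - ε) ^ 2 + (2 * (1 - ε) * ε) * A.indicator g x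
      + ε ^ 2 * A.indicator g x ^ 2 := by
    ext x; simp only [hf]; ring
  have hf2i : Integrable (fun x => f x ^ 2) P := by
    rw [hf2]
    exact ((integrable_const _).add (hiA.const_mul _)).add (hiA2.const_mul _)
  have hQ1 : Q.real A ≤ 1 := measureReal_le_one
  have hQ0 : 0 ≤ Q.real A := measureReal_nonneg
  have hQc := probReal_compl_eq_one_sub (μ := Q) hA
  have hIf : ∫ x, f x ∂P = 1 - ε * Q.real Aᶜ := by
    simp only [hf]
    rw [integral_add (integrable_const _) (hiA.const_mul _), integral_const_mul, hIA]
    simp [hQc]; ring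
  have hIf2 : ∫ x, f x ^ 2 ∂P ≤ 1 + ε ^ 2 * G := by
    have hi1 : Integrable (fun x => (1 - ε) ^ 2 + (2 * (1 - ε) * ε) * A.indicator g x) P :=
      (integrable_const _).add (hiA.const_mul _)
    rw [hf2, integral_add hi1 (hiA2.const_mul _),
      integral_add (integrable_const _) (hiA.const_mul _), integral_const_mul,
      integral_const_mul, hIA]
    simp only [integral_const, probReal_univ, one_smul]
    have : ε ^ 2 * ∫ x, A.indicator g x ^ 2 ∂P ≤ ε ^ 2 * G := by gcongr
    nlinarith [mul_nonneg (mul_nonneg (sub_nonneg.2 hε1) hε0) (sub_nonneg.2 hQ1)]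
  -- The product density.
  set F : (Fin n → Ω) → ℝ := fun x => ∏ i, f (x i) with hF
  have hF0 : ∀ x, 0 ≤ F x := fun x => Finset.prod_nonneg fun i _ => hf0 _
  have hFm : Measurable F := Finset.measurable_fun_prod _ fun i _ => hfm.comp (measurable_pi_apply i)
  have hFi : Integrable F Pn := Integrable.fintype_prod (fun _ => hfi)
  have hF2 : (fun x => F x ^ 2) = fun x : Fin n → Ω => ∏ i, (f (x i) ^ 2) := by
    ext x; simp [hF, Finset.prod_pow]
  have hF2i : Integrable (fun x => F x ^ 2) Pn := by
    rw [hF2]; exact Integrable.fintype_prod (f := fun _ y => f y ^ 2) (fun _ => hf2i)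
  have hIF : ∫ x, F x ∂Pn = (1 - ε * Q.real Aᶜ) ^ n := by
    rw [← hIf, hPn]
    simpa using integral_fintype_prod_eq_pow (ι := Fin n) (μ := P) f
  have hIF2 : ∫ x, F x ^ 2 ∂Pn ≤ Real.exp (n * (ε ^ 2 * G)) := by
    have h1 : ∫ x, F x ^ 2 ∂Pn = (∫ x, f x ^ 2 ∂P) ^ n := by
      rw [hF2, hPn]
      simpa using integral_fintype_prod_eq_pow (ι := Fin n) (μ := P) (fun y => f y ^ 2)
    rw [h1, Real.exp_nat_mul]
    have h2 : 0 ≤ ∫ x, f x ^ 2 ∂P := integral_nonneg fun x => sq_nonneg _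
    refine pow_le_pow_left₀ h2 (hIf2.trans ?_) n
    linarith [Real.add_one_le_exp (ε ^ 2 * G)]
  have hκ0 : 0 ≤ ε * Q.real Aᶜ := by positivity
  have hIFge : 1 - n * κ ≤ ∫ x, F x ∂Pn := by
    rw [hIF]
    have h1 : ε * Q.real Aᶜ ≤ 1 := by
      have : Q.real Aᶜ ≤ 1 := measureReal_le_one
      nlinarith [measureReal_nonneg (μ := Q) (s := Aᶜ)]
    refine le_trans ?_ (one_sub_mul_le_pow h1 n)
    have : (n : ℝ) * (ε * Q.real Aᶜ) ≤ n * κ := by gcongr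
    linarith
  have hDi : Integrable (fun x => |F x - 1|) Pn := (hFi.sub (integrable_const _)).abs
  have hD2 : (fun x => |F x - 1| ^ 2) = fun x => F x ^ 2 - 2 * F x + 1 := by
    ext x; rw [sq_abs]; ring
  have hD2i : Integrable (fun x => |F x - 1| ^ 2) Pn := by
    rw [hD2]; exact (hF2i.sub (hFi.const_mul _)).add (integrable_const _)
  have hID2 : ∫ x, |F x - 1| ^ 2 ∂Pn ≤ Real.exp (n * (ε ^ 2 * G)) - 1 + 2 * (n * κ) := by
    have hi1 : Integrable (fun x => F x ^ 2 - 2 * F x) Pn := hF2i.sub (hFi.const_mul _)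
    rw [hD2, integral_add hi1 (integrable_const _),
      integral_sub hF2i (hFi.const_mul _), integral_const_mul]
    simp only [integral_const, probReal_univ, one_smul]
    linarith
  have hID : ∫ x, |F x - 1| ∂Pn ≤ √(Real.exp (n * (ε ^ 2 * G)) - 1 + 2 * (n * κ)) := by
    refine Real.le_sqrt_of_sq_le (le_trans ?_ hID2)
    have hLp : MemLp (fun x => |F x - 1|) 2 Pn :=
      (memLp_two_iff_integrable_sq hDi.aestronglyMeasurable).2 hD2i
    -- Nonnegative variance serves as the Cauchy–Schwarz inequality between the first and second
    -- moments.
    have := variance_nonneg (fun x => |F x - 1|) Pn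
    rw [variance_eq_sub hLp] at this
    simpa using this
  -- The mixture dominates the measure with density `F`.
  set d : Ω → ENNReal := fun x => ENNReal.ofReal (1 - ε) + ENNReal.ofReal ε * ENNReal.ofReal (g x)
    with hd
  have hdm : Measurable d := by fun_prop
  have hM : ENNReal.ofReal (1 - ε) • P + ENNReal.ofReal ε • Q = P.withDensity d := by
    have : d = (fun _ => ENNReal.ofReal (1 - ε)) +
        ENNReal.ofReal ε • fun x => ENNReal.ofReal (g x) := by
      ext x; simp [hd]
    rw [this, withDensity_add_left measurable_const, withDensity_const,
      withDensity_smul _ (by fun_prop), ← hQ]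
  have hMp : IsProbabilityMeasure (P.withDensity d) := by
    rw [← hM]
    constructor
    simp [← ENNReal.ofReal_add (sub_nonneg.2 hε1) hε0]
  have hfd : ∀ x, ENNReal.ofReal (f x) ≤ d x := by
    intro x
    simp only [hf, hd]
    rw [ENNReal.ofReal_add (by linarith) (mul_nonneg hε0 (hind0 x)), ENNReal.ofReal_mul hε0]
    gcongr
    by_cases hx : x ∈ A <;> simp [hx, hg0]
  refine le_minTotalError fun R hR => ?_
  have hMR : ∫ x in Rᶜ, F x ∂Pn ≤
      (Measure.pi fun _ : Fin n => P.withDensity d).real Rᶜ := by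
    rw [integral_eq_lintegral_of_nonneg_ae (ae_of_all _ hF0) hFm.aestronglyMeasurable, Measure.real]
    refine ENNReal.toReal_mono (measure_ne_top _ _) ?_
    rw [pi_withDensity P d hdm, withDensity_apply _ hR.compl]
    refine lintegral_mono fun x => ?_
    rw [hF, ENNReal.ofReal_prod_of_nonneg fun i _ => hf0 _]
    exact Finset.prod_le_prod' fun i _ => hfd _
  rw [hM]
  have hPR := probReal_compl_eq_one_sub (μ := Pn) hR
  have h1 : ∫ x in Rᶜ, (1 - F x) ∂Pn = Pn.real Rᶜ - ∫ x in Rᶜ, F x ∂Pn := by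
    rw [integral_sub (integrable_const _) hFi.integrableOn]; simp
  have h2 : ∫ x in Rᶜ, (1 - F x) ∂Pn ≤ ∫ x, |F x - 1| ∂Pn := by
    refine le_trans (integral_mono ((integrable_const _).sub hFi.integrableOn)
      hDi.integrableOn fun x => ?_) (setIntegral_le_integral hDi (ae_of_all _ fun x => abs_nonneg _))
    show 1 - F x ≤ |F x - 1|
    rw [abs_sub_comm]; exact le_abs_self _
  linarith

end TotalError

/-! ### Gaussian pairs: likelihood ratios, tails and the squared norm. -/

section Gaussian

/-- The law of `(Y, Z)` for independent `Y ∼ N(m, 1)` and `Z ∼ N(0, 1)`. -/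
noncomputable def gaussPair (m : ℝ) : Measure (ℝ × ℝ) :=
  (gaussianReal m 1).prod (gaussianReal 0 1)

instance (m : ℝ) : IsProbabilityMeasure (gaussPair m) := by
  unfold gaussPair; infer_instance

lemma measurable_sqNorm : Measurable (fun z : ℝ × ℝ => z.1 ^ 2 + z.2 ^ 2) := by fun_prop

lemma noncentralChiSq2_eq (δ : ℝ) :
    noncentralChiSq2 δ = (gaussPair √δ).map (fun z : ℝ × ℝ => z.1 ^ 2 + z.2 ^ 2) := rfl

instance (δ : ℝ) : IsProbabilityMeasure (noncentralChiSq2 δ) := by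
  rw [noncentralChiSq2_eq]
  exact Measure.isProbabilityMeasure_map measurable_sqNorm.aemeasurable

instance : IsProbabilityMeasure exp2 := isProbabilityMeasure_expMeasure (by norm_num)

lemma gaussianReal_eq_withDensity (m : ℝ) :
    gaussianReal m 1 =
      (gaussianReal 0 1).withDensity fun y => ENNReal.ofReal (Real.exp (m * y - m ^ 2 / 2)) := by
  rw [gaussianReal_of_var_ne_zero m one_ne_zero, gaussianReal_of_var_ne_zero 0 one_ne_zero,
    ← withDensity_mul _ (measurable_gaussianPDF 0 1) (by fun_prop)]
  congr 1
  ext y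
  simp only [Pi.mul_apply, gaussianPDF]
  rw [← ENNReal.ofReal_mul (gaussianPDFReal_nonneg _ _ _)]
  congr 1
  simp only [gaussianPDFReal]
  rw [mul_assoc _ (Real.exp _), ← Real.exp_add]
  congr 2
  simp; ring

lemma gaussPair_eq_withDensity (m : ℝ) :
    gaussPair m =
      (gaussPair 0).withDensity fun z => ENNReal.ofReal (Real.exp (m * z.1 - m ^ 2 / 2)) := by
  unfold gaussPair
  rw [gaussianReal_eq_withDensity m, prod_withDensity_left (by fun_prop)]

lemma gaussianReal_real_Ioi_eq (m t : ℝ) :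
    (gaussianReal m 1).real (Set.Ioi t) = (gaussianReal 0 1).real (Set.Ioi (t - m)) := by
  have h := gaussianReal_map_add_const (μ := 0) (v := 1) m
  rw [zero_add] at h
  rw [← h, map_measureReal_apply (by fun_prop) measurableSet_Ioi]
  congr 1; ext x; simp [sub_lt_iff_lt_add]

lemma gaussianReal_real_Iic_eq (m t : ℝ) :
    (gaussianReal m 1).real (Set.Iic t) = (gaussianReal 0 1).real (Set.Ici (m - t)) := by
  have h := gaussianReal_map_neg (μ := -m) (v := 1)
  have h' := gaussianReal_map_add_const (μ := 0) (v := 1) (-m)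
  rw [neg_neg] at h
  rw [zero_add] at h'
  rw [← h, ← h', Measure.map_map (by fun_prop) (by fun_prop),
    map_measureReal_apply (by fun_prop) measurableSet_Iic]
  congr 1; ext x; simp only [Set.mem_preimage, Function.comp, Set.mem_Iic, Set.mem_Ici]
  constructor <;> intro h <;> linarith

/-- Chernoff's bound with the optimal parameter `t`. -/
lemma gaussianReal_real_Ici_le {t : ℝ} (ht : 0 ≤ t) :
    (gaussianReal 0 1).real (Set.Ici t) ≤ Real.exp (-t ^ 2 / 2) := by
  have h := measure_ge_le_exp_mul_mgf (μ := gaussianReal 0 1) (X := id) t ht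
    (by simpa using integrable_exp_mul_gaussianReal (μ := 0) (v := 1) t)
  rw [mgf_id_gaussianReal] at h
  refine le_trans (le_of_eq ?_) (h.trans (le_of_eq ?_))
  · congr 1
  · rw [← Real.exp_add]; congr 1; simp; ring

/-- On an interval of length one the density is at least its value at the right end. This is crude,
but the exponents of `n` do not feel the loss. -/
lemma le_gaussianReal_real_Ioi {t : ℝ} (ht : 0 ≤ t) :
    (√(2 * Real.pi))⁻¹ * Real.exp (-(t + 1) ^ 2 / 2) ≤ (gaussianReal 0 1).real (Set.Ioi t) := by
  have h1 : (gaussianReal 0 1).real (Set.Ioc t (t + 1)) ≤ (gaussianReal 0 1).real (Set.Ioi t) :=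
    measureReal_mono fun x hx => hx.1
  refine le_trans ?_ h1
  rw [Measure.real, gaussianReal_apply_eq_integral 0 one_ne_zero,
    ENNReal.toReal_ofReal (setIntegral_nonneg measurableSet_Ioc
      fun x _ => gaussianPDFReal_nonneg _ _ _)]
  have h2 : ∫ x in Set.Ioc t (t + 1), (√(2 * Real.pi))⁻¹ * Real.exp (-(t + 1) ^ 2 / 2) ≤
      ∫ x in Set.Ioc t (t + 1), gaussianPDFReal 0 1 x := by
    refine setIntegral_mono_on (integrableOn_const (by simp)) (integrable_gaussianPDFReal 0 1).integrableOn
      measurableSet_Ioc fun x hx => ?_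
    simp only [gaussianPDFReal, NNReal.coe_one, mul_one, sub_zero]
    gcongr
    · linarith [hx.1]
    · exact hx.2
  simpa using h2

/-- The standard normal pair has exponentially distributed squared norm. -/
lemma noncentralChiSq2_zero : noncentralChiSq2 0 = exp2 := by
  have key : ∀ x : ℝ, 0 ≤ x →
      noncentralChiSq2 0 (Set.Ioi x) = ENNReal.ofReal (Real.exp (-x / 2)) := by
    intro x hx
    have hE : MeasurableSet ((fun z : ℝ × ℝ => z.1 ^ 2 + z.2 ^ 2) ⁻¹' Set.Ioi x) :=
      measurable_sqNorm measurableSet_Ioi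
    rw [noncentralChiSq2_eq, Measure.map_apply measurable_sqNorm measurableSet_Ioi, Real.sqrt_zero]
    unfold gaussPair
    rw [gaussianReal_of_var_ne_zero 0 one_ne_zero, prod_withDensity
      (measurable_gaussianPDF 0 1) (measurable_gaussianPDF 0 1), withDensity_apply _ hE,
      ← lintegral_indicator hE, ← Measure.volume_eq_prod, ← lintegral_comp_polarCoord_symm]
    -- In polar coordinates the integrand depends on the radius alone; the angle contributes `2π`,
    -- and the radial integral has an explicit antiderivative.
    have h1 : ∀ p ∈ polarCoord.target, ENNReal.ofReal p.1 •
        ((fun z : ℝ × ℝ => z.1 ^ 2 + z.2 ^ 2) ⁻¹' Set.Ioi x).indicator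
          (fun z : ℝ × ℝ => gaussianPDF 0 1 z.1 * gaussianPDF 0 1 z.2) (polarCoord.symm p) =
        (Set.Ioi √x).indicator (fun s => ENNReal.ofReal
          ((2 * Real.pi)⁻¹ * (s * Real.exp (-s ^ 2 / 2)))) p.1 := by
      intro p hp
      have hp1 : 0 < p.1 := hp.1
      have hsq : (p.1 * Real.cos p.2) ^ 2 + (p.1 * Real.sin p.2) ^ 2 = p.1 ^ 2 := by
        have := Real.sin_sq_add_cos_sq p.2
        linear_combination p.1 ^ 2 * this
      rw [polarCoord_symm_apply]
      by_cases hps : √x < p.1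
      · have : x < p.1 ^ 2 := (Real.sqrt_lt hx hp1.le).1 hps
        rw [Set.indicator_of_mem (by simpa [hsq] using this), Set.indicator_of_mem (by exact hps)]
        simp only [gaussianPDF, smul_eq_mul]
        rw [← ENNReal.ofReal_mul (gaussianPDFReal_nonneg _ _ _), ← ENNReal.ofReal_mul hp1.le]
        congr 1
        simp only [gaussianPDFReal, NNReal.coe_one, mul_one, sub_zero]
        have h2 : √(2 * Real.pi) * √(2 * Real.pi) = 2 * Real.pi :=
          Real.mul_self_sqrt (by positivity)
        rw [mul_mul_mul_comm, ← Real.exp_add, ← mul_inv, h2, ← hsq]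
        ring_nf
      · have : ¬ x < p.1 ^ 2 := fun h => hps ((Real.sqrt_lt hx hp1.le).2 h)
        rw [Set.indicator_of_notMem (by simpa [hsq] using this),
          Set.indicator_of_notMem (by simpa using hps)]
        simp
    have hT : MeasurableSet polarCoord.target := polarCoord.open_target.measurableSet
    rw [setLIntegral_congr_fun hT h1]
    have hTe : polarCoord.target = Set.Ioi (0 : ℝ) ×ˢ Set.Ioo (-Real.pi) Real.pi := rfl
    have hfm : Measurable fun s : ℝ => ENNReal.ofReal
          ((2 * Real.pi)⁻¹ * (s * Real.exp (-s ^ 2 / 2))) := by fun_prop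
    have hfm' : Measurable fun p : ℝ × ℝ => (Set.Ioi √x).indicator (fun s => ENNReal.ofReal
          ((2 * Real.pi)⁻¹ * (s * Real.exp (-s ^ 2 / 2)))) p.1 :=
      (hfm.indicator measurableSet_Ioi).comp measurable_fst
    rw [hTe, Measure.volume_eq_prod, ← Measure.prod_restrict,
      lintegral_prod _ hfm'.aemeasurable]
    simp only [lintegral_const, Measure.restrict_apply MeasurableSet.univ, Set.univ_inter,
      Real.volume_Ioo]
    rw [lintegral_mul_const _ (hfm.indicator measurableSet_Ioi),
      lintegral_indicator measurableSet_Ioi,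
      Measure.restrict_restrict measurableSet_Ioi, Set.Ioi_inter_Ioi,
      sup_of_le_left (Real.sqrt_nonneg x)]
    have hd : ∀ s ∈ Set.Ici √x, HasDerivAt (fun s => -((2 * Real.pi)⁻¹ * Real.exp (-s ^ 2 / 2)))
        ((2 * Real.pi)⁻¹ * (s * Real.exp (-s ^ 2 / 2))) s := by
      intro s _
      have h := ((((hasDerivAt_id s).pow 2).neg.div_const 2).exp.const_mul ((2 * Real.pi)⁻¹)).neg
      refine h.congr_deriv ?_
      simp; ring
    have hnn : ∀ s ∈ Set.Ioi √x, 0 ≤ (2 * Real.pi)⁻¹ * (s * Real.exp (-s ^ 2 / 2)) := by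
      intro s hs
      have : 0 < s := lt_of_le_of_lt (Real.sqrt_nonneg x) hs
      positivity
    have hlim : Tendsto (fun s => -((2 * Real.pi)⁻¹ * Real.exp (-s ^ 2 / 2))) atTop (𝓝 0) := by
      have h0 : Tendsto (fun s : ℝ => -s ^ 2 / 2) atTop atBot := by
        have : Tendsto (fun s : ℝ => s ^ 2 / 2) atTop atTop :=
          (tendsto_pow_atTop two_ne_zero).atTop_div_const (by norm_num)
        exact (tendsto_neg_atTop_atBot.comp this).congr fun s => by simp; ring
      have := ((Real.tendsto_exp_atBot.comp h0).const_mul ((2 * Real.pi)⁻¹)).neg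
      simpa using this
    have hint := integrableOn_Ioi_deriv_of_nonneg' hd hnn hlim
    have hval := integral_Ioi_of_hasDerivAt_of_tendsto' hd hint hlim
    rw [← ofReal_integral_eq_lintegral_ofReal hint
      ((ae_restrict_iff' measurableSet_Ioi).2 (ae_of_all _ hnn)), hval,
      ← ENNReal.ofReal_mul (by rw [zero_sub, neg_neg]; positivity), Real.sq_sqrt hx]
    congr 1
    have := Real.pi_pos
    field_simp
    ring
  have hreal : ∀ x : ℝ, 0 ≤ x → (noncentralChiSq2 0).real (Set.Iic x) = 1 - Real.exp (-x / 2) := by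
    intro x hx
    have := probReal_compl_eq_one_sub (μ := noncentralChiSq2 0) (measurableSet_Ioi (a := x))
    rw [Set.compl_Ioi] at this
    rw [this, Measure.real, key x hx, ENNReal.toReal_ofReal (Real.exp_nonneg _)]
  refine Measure.eq_of_cdf _ _ ?_
  ext x
  unfold exp2
  rw [cdf_expMeasure_eq (by norm_num), cdf_eq_real]
  split_ifs with hx
  · rw [hreal x hx]; congr 2; ring
  · have h0 := hreal 0 le_rfl
    have hle : (noncentralChiSq2 0).real (Set.Iic x) ≤ (noncentralChiSq2 0).real (Set.Iic 0) :=
      measureReal_mono (Set.Iic_subset_Iic.2 (not_le.1 hx).le)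
    rw [h0] at hle
    simp at hle
    exact le_antisymm hle measureReal_nonneg

end Gaussian

/-! ### The chi-squared model as an image of the Gaussian model. -/

section Models

instance (n : ℕ) : IsProbabilityMeasure (nullLaw n) := by unfold nullLaw; infer_instance

lemma isProbabilityMeasure_mix {Ω : Type*} [MeasurableSpace Ω] (P Q : Measure Ω)
    [IsProbabilityMeasure P] [IsProbabilityMeasure Q] {ε : ℝ} (h0 : 0 ≤ ε) (h1 : ε ≤ 1) :
    IsProbabilityMeasure (ENNReal.ofReal (1 - ε) • P + ENNReal.ofReal ε • Q) := by
  constructor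
  simp [← ENNReal.ofReal_add (sub_nonneg.2 h1) h0]

lemma rpow_neg_le_one {β : ℝ} (hβ : 0 < β) (n : ℕ) : (n : ℝ) ^ (-β) ≤ 1 := by
  rcases Nat.eq_zero_or_pos n with rfl | hn
  · simp [Real.zero_rpow (neg_ne_zero.2 hβ.ne')]
  · exact Real.rpow_le_one_of_one_le_of_nonpos (by exact_mod_cast hn) (by linarith)

lemma isProbabilityMeasure_mixture {β : ℝ} (hβ : 0 < β) (δ : ℝ) (n : ℕ) :
    IsProbabilityMeasure (mixture ((n : ℝ) ^ (-β)) δ) :=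
  isProbabilityMeasure_mix _ _ (by positivity) (rpow_neg_le_one hβ n)

lemma isProbabilityMeasure_altLaw {β : ℝ} (hβ : 0 < β) (r : ℝ) (n : ℕ) :
    IsProbabilityMeasure (altLaw β r n) := by
  have := fun n δ => isProbabilityMeasure_mixture hβ δ n
  unfold altLaw; infer_instance

/-- The Gaussian location mixture from which the chi-squared mixture arises by passing to the
squared norm. -/
noncomputable def gaussMixture (ε m : ℝ) : Measure (ℝ × ℝ) :=
  ENNReal.ofReal (1 - ε) • gaussPair 0 + ENNReal.ofReal ε • gaussPair m

lemma map_gaussMixture (ε δ : ℝ) :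
    (gaussMixture ε √δ).map (fun z : ℝ × ℝ => z.1 ^ 2 + z.2 ^ 2) = mixture ε δ := by
  unfold gaussMixture mixture
  rw [Measure.map_add _ _ measurable_sqNorm, Measure.map_smul, Measure.map_smul,
    ← noncentralChiSq2_zero, noncentralChiSq2_eq, noncentralChiSq2_eq, Real.sqrt_zero]

/-- Squared norms are a statistic of the pairs. This inequality lets the merging argument use the
explicit Gaussian likelihood ratio instead of the noncentral density. -/
lemma le_minTotalError_laws {β : ℝ} (hβ : 0 < β) (r : ℝ) (n : ℕ) :
    minTotalError (Measure.pi fun _ : Fin n => gaussPair 0)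
      (Measure.pi fun _ : Fin n => gaussMixture ((n : ℝ) ^ (-β)) √(2 * r * Real.log n)) ≤
    minTotalError (nullLaw n) (altLaw β r n) := by
  have hT : Measurable fun (x : Fin n → ℝ × ℝ) i => (x i).1 ^ 2 + (x i).2 ^ 2 := by fun_prop
  have h := minTotalError_map (Measure.pi fun _ : Fin n => gaussPair 0)
    (Measure.pi fun _ : Fin n => gaussMixture ((n : ℝ) ^ (-β)) √(2 * r * Real.log n)) hT
  refine h.trans (le_of_eq ?_)
  have hp : IsProbabilityMeasure (gaussMixture ((n : ℝ) ^ (-β)) √(2 * r * Real.log n)) :=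
    isProbabilityMeasure_mix _ _ (by positivity) (rpow_neg_le_one hβ n)
  have h1 : IsProbabilityMeasure (Measure.map (fun z : ℝ × ℝ => z.1 ^ 2 + z.2 ^ 2)
      (gaussPair 0)) := Measure.isProbabilityMeasure_map measurable_sqNorm.aemeasurable
  have h2 : IsProbabilityMeasure (Measure.map (fun z : ℝ × ℝ => z.1 ^ 2 + z.2 ^ 2)
      (gaussMixture ((n : ℝ) ^ (-β)) √(2 * r * Real.log n))) :=
    Measure.isProbabilityMeasure_map measurable_sqNorm.aemeasurable
  congr 1
  · rw [Measure.pi_map_pi (f := fun _ (z : ℝ × ℝ) => z.1 ^ 2 + z.2 ^ 2)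
      fun _ => measurable_sqNorm.aemeasurable]
    unfold nullLaw
    congr 1; ext1 i
    rw [← noncentralChiSq2_zero, noncentralChiSq2_eq, Real.sqrt_zero]
  · rw [Measure.pi_map_pi (f := fun _ (z : ℝ × ℝ) => z.1 ^ 2 + z.2 ^ 2)
      fun _ => measurable_sqNorm.aemeasurable]
    unfold altLaw
    congr 1; ext1 i
    exact map_gaussMixture _ _

end Models

/-! ### Merging below the boundary. -/

section Boundary

lemma rhoStar_pos {β : ℝ} (hβ : 1 / 2 < β) : 0 < rhoStar β := by
  unfold rhoStar
  split_ifs with h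
  · linarith
  · have : √(1 - β) < 1 := by
      rw [Real.sqrt_lt' one_pos]; linarith
    have : 0 < 1 - √(1 - β) := by linarith
    positivity

/-- The two branches differ by `2 (√(1 - β) - 1/2)²`, so they touch at `β = 3/4`. -/
lemma rhoStar_le {β : ℝ} (hβ' : β < 1) : rhoStar β ≤ (1 - √(1 - β)) ^ 2 := by
  unfold rhoStar
  split_ifs with h
  · have := Real.sq_sqrt (show 0 ≤ 1 - β by linarith)
    nlinarith [sq_nonneg (√(1 - β) - 1 / 2)]
  · exact le_rfl

lemma lt_one_sub_sqrt_of_lt_rhoStar {β r : ℝ} (hβ : 1 / 2 < β) (hβ' : β < 1)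
    (hr : r < rhoStar β) : √r < 1 - √(1 - β) := by
  have h1 : √(1 - β) < 1 := by rw [Real.sqrt_lt' one_pos]; linarith
  rw [Real.sqrt_lt' (by linarith)]
  exact hr.trans_le (rhoStar_le hβ')

/-- The second inequality makes the expected number of shifted observations beyond `√(2 log n)`, at
most `n^(1 - β - (1 - √r)²)`, vanish. -/
lemma one_sub_lt_of_lt_rhoStar {β r : ℝ} (hβ : 1 / 2 < β) (hβ' : β < 1)
    (hr : r < rhoStar β) : √r < 1 ∧ 1 - β < (1 - √r) ^ 2 := by
  have h := lt_one_sub_sqrt_of_lt_rhoStar hβ hβ' hr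
  have h0 := Real.sqrt_pos.2 (show 0 < 1 - β by linarith)
  refine ⟨by linarith, ?_⟩
  have h2 : √(1 - β) < 1 - √r := by linarith
  have h3 := Real.sq_sqrt (show 0 ≤ 1 - β by linarith)
  nlinarith

lemma lt_sub_half_of_lt_rhoStar {β r : ℝ} (hr : r < rhoStar β) (hr4 : r ≤ 1 / 4) :
    r < β - 1 / 2 := by
  unfold rhoStar at hr
  split_ifs at hr with h
  · exact hr
  · push Not at h; linarith

/-- Below the boundary the truncated second moment is `n ^ γ` with `γ < 2 β - 1`. -/
lemma exists_secondMoment_exponent {β r : ℝ} (hβ : 1 / 2 < β) (hβ' : β < 1) (hr0 : 0 < r)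
    (hr : r < rhoStar β) : ∃ γ < 2 * β - 1, ∀ T : ℝ, 0 ≤ T →
      Real.exp ((√r * T) ^ 2) * (gaussianReal (2 * (√r * T)) 1).real (Set.Iic T) ≤
        Real.exp (γ * (T ^ 2 / 2)) := by
  have hrs := Real.sq_sqrt hr0.le
  have hs0 := Real.sqrt_nonneg r
  rcases le_total r (1 / 4) with h4 | h4
  -- For `r ≤ 1/4` the mean `2√r T` lies below `T`, so truncation brings no gain and the probability
  -- is bounded by one.
  · refine ⟨2 * r, by linarith [lt_sub_half_of_lt_rhoStar hr h4], fun T hT => ?_⟩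
    calc _ ≤ Real.exp ((√r * T) ^ 2) * 1 := by gcongr; exact measureReal_le_one
      _ = _ := by rw [mul_one]; congr 1; rw [mul_pow, hrs]; ring
  · have h2 : 1 / 2 ≤ √r := by
      rw [Real.le_sqrt (by norm_num) hr0.le]; linarith
    refine ⟨2 * r - (2 * √r - 1) ^ 2, ?_, fun T hT => ?_⟩
    · have := (one_sub_lt_of_lt_rhoStar hβ hβ' hr).2
      nlinarith
    · rw [gaussianReal_real_Iic_eq]
      have ht : 0 ≤ 2 * (√r * T) - T := by nlinarith
      calc _ ≤ Real.exp ((√r * T) ^ 2) * Real.exp (-(2 * (√r * T) - T) ^ 2 / 2) := by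
            gcongr; exact gaussianReal_real_Ici_le ht
        _ = _ := by
            rw [← Real.exp_add]; congr 1; rw [mul_pow, hrs]; ring

lemma gaussPair_real_fst (m : ℝ) {s : Set ℝ} :
    (gaussPair m).real (Prod.fst ⁻¹' s) = (gaussianReal m 1).real s := by
  have : (Prod.fst ⁻¹' s : Set (ℝ × ℝ)) = s ×ˢ Set.univ := by ext; simp
  rw [gaussPair, this, Measure.real, Measure.prod_prod]
  simp [Measure.real]

/-- The squared likelihood ratio for the shift `m` is `exp (m²)` times the likelihood ratio for the
shift `2m`. -/
lemma gaussPair_secondMoment (m T : ℝ) :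
    IntegrableOn (fun z : ℝ × ℝ => Real.exp (m * z.1 - m ^ 2 / 2) ^ 2)
        (Prod.fst ⁻¹' Set.Iic T) (gaussPair 0) ∧
      ∫ z in Prod.fst ⁻¹' Set.Iic T, Real.exp (m * z.1 - m ^ 2 / 2) ^ 2 ∂(gaussPair 0) =
        Real.exp (m ^ 2) * (gaussianReal (2 * m) 1).real (Set.Iic T) := by
  have hA : MeasurableSet (Prod.fst ⁻¹' Set.Iic T : Set (ℝ × ℝ)) :=
    measurable_fst measurableSet_Iic
  have hf : (fun z : ℝ × ℝ => Real.exp (m * z.1 - m ^ 2 / 2) ^ 2) =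
      fun z => Real.exp (m ^ 2) * Real.exp (2 * m * z.1 - (2 * m) ^ 2 / 2) := by
    ext z; rw [← Real.exp_nat_mul, ← Real.exp_add]; congr 1; push_cast; ring
  have hl : ∀ B, MeasurableSet B → ∫⁻ z in B, ENNReal.ofReal
      (Real.exp (2 * m * z.1 - (2 * m) ^ 2 / 2)) ∂(gaussPair 0) = gaussPair (2 * m) B := by
    intro B hB
    rw [gaussPair_eq_withDensity (2 * m), withDensity_apply _ hB]
  have hi : IntegrableOn (fun z : ℝ × ℝ => Real.exp (2 * m * z.1 - (2 * m) ^ 2 / 2))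
      (Prod.fst ⁻¹' Set.Iic T) (gaussPair 0) := by
    refine ⟨by fun_prop, ?_⟩
    rw [hasFiniteIntegral_iff_ofReal (ae_of_all _ fun z => (Real.exp_nonneg _)), hl _ hA]
    exact measure_lt_top _ _
  rw [hf]
  refine ⟨hi.const_mul _, ?_⟩
  rw [integral_const_mul, ← gaussPair_real_fst, Measure.real, ← hl _ hA,
    integral_eq_lintegral_of_nonneg_ae (ae_of_all _ fun z => (Real.exp_nonneg _)) (by fun_prop)]

lemma tendsto_natCast_rpow_zero {a : ℝ} (ha : a < 0) :
    Tendsto (fun n : ℕ => (n : ℝ) ^ a) atTop (𝓝 0) := by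
  have := (tendsto_rpow_neg_atTop (neg_pos.2 ha)).comp tendsto_natCast_atTop_atTop
  simpa [Function.comp_def] using this

/-- Below the boundary the hypotheses merge asymptotically. -/
theorem merge_of_lt_rhoStar {β r : ℝ} (hβ : 1 / 2 < β) (hβ' : β < 1) (hr0 : 0 < r)
    (hr : r < rhoStar β) : Merge β r := by
  obtain ⟨γ, hγ, hG⟩ := exists_secondMoment_exponent hβ hβ' hr0 hr
  obtain ⟨hr1, htail⟩ := one_sub_lt_of_lt_rhoStar hβ hβ' hr
  have hβ0 : 0 < β := by linarith
  have h1 : Tendsto (fun n : ℕ => (n : ℝ) ^ (1 - 2 * β + γ)) atTop (𝓝 0) :=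
    tendsto_natCast_rpow_zero (by linarith)
  have h2 : Tendsto (fun n : ℕ => (n : ℝ) ^ (1 - β - (1 - √r) ^ 2)) atTop (𝓝 0) :=
    tendsto_natCast_rpow_zero (by linarith)
  have hlim : Tendsto (fun n : ℕ => 1 - √(Real.exp ((n : ℝ) ^ (1 - 2 * β + γ)) - 1 +
      2 * (n : ℝ) ^ (1 - β - (1 - √r) ^ 2))) atTop (𝓝 1) := by
    have := ((((Real.continuous_exp.tendsto 0).comp h1).sub_const 1).add
      (h2.const_mul 2)).sqrt.const_sub 1
    simpa using this
  refine tendsto_of_tendsto_of_tendsto_of_le_of_le' hlim tendsto_const_nhds ?_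
    (Eventually.of_forall fun n => ?_)
  · filter_upwards [eventually_ge_atTop 1] with n hn
    have hn0 : (0 : ℝ) < n := by exact_mod_cast hn
    have hL : 0 ≤ Real.log n := Real.log_natCast_nonneg n
    refine le_trans ?_ (le_minTotalError_laws hβ0 r n)
    -- The truncation point has the size of the maximum of `n` standard normals; `exp (T² / 2) = n`
    -- turns Gaussian exponents into powers of `n`.
    set T := √(2 * Real.log n) with hT
    have hT2 : T ^ 2 / 2 = Real.log n := by
      rw [hT, Real.sq_sqrt (by positivity)]; ring
    have hm : √(2 * r * Real.log n) = √r * T := by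
      rw [hT, ← Real.sqrt_mul hr0.le]; congr 1; ring
    obtain ⟨hi, hsm⟩ := gaussPair_secondMoment (√r * T) T
    have hA : MeasurableSet (Prod.fst ⁻¹' Set.Iic T : Set (ℝ × ℝ)) :=
      measurable_fst measurableSet_Iic
    have hQc : (gaussPair (√r * T)).real (Prod.fst ⁻¹' Set.Iic T)ᶜ ≤
        (n : ℝ) ^ (-(1 - √r) ^ 2) := by
      rw [← Set.preimage_compl, gaussPair_real_fst, Set.compl_Iic, gaussianReal_real_Ioi_eq]
      have h0 : 0 ≤ T - √r * T := by
        have : 0 ≤ T := Real.sqrt_nonneg _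
        nlinarith
      refine (measureReal_mono Set.Ioi_subset_Ici_self).trans
        ((gaussianReal_real_Ici_le h0).trans (le_of_eq ?_))
      rw [Real.rpow_def_of_pos hn0, ← hT2]; congr 1; ring
    have hκ : (n : ℝ) ^ (-β) * (gaussPair (√r * T)).real (Prod.fst ⁻¹' Set.Iic T)ᶜ ≤
        (n : ℝ) ^ (-β) * (n : ℝ) ^ (-(1 - √r) ^ 2) := by gcongr
    have := minTotalError_pi_ge (g := fun z : ℝ × ℝ => Real.exp (√r * T * z.1 - (√r * T) ^ 2 / 2))
      (by fun_prop) (fun z => Real.exp_nonneg _) (gaussPair_eq_withDensity (√r * T)) hA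
      (show 0 ≤ (n : ℝ) ^ (-β) by positivity) (rpow_neg_le_one hβ0 n) hi
      (hsm.trans_le (hG T (Real.sqrt_nonneg _))) hκ n
    rw [hm]
    refine le_trans (le_of_eq ?_) this
    have e1 : (n : ℝ) * (((n : ℝ) ^ (-β)) ^ 2 * Real.exp (γ * (T ^ 2 / 2))) =
        (n : ℝ) ^ (1 - 2 * β + γ) := by
      rw [hT2, Real.rpow_def_of_pos hn0, Real.rpow_def_of_pos hn0, ← Real.exp_nat_mul,
        ← Real.exp_add]
      nth_rewrite 1 [← Real.exp_log hn0]
      rw [← Real.exp_add]; congr 1; push_cast; ring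
    have e2 : (n : ℝ) * ((n : ℝ) ^ (-β) * (n : ℝ) ^ (-(1 - √r) ^ 2)) =
        (n : ℝ) ^ (1 - β - (1 - √r) ^ 2) := by
      rw [← Real.rpow_add hn0]
      nth_rewrite 1 [← Real.rpow_one (n : ℝ)]
      rw [← Real.rpow_add hn0]; congr 1; ring
    rw [e1, e2]
  · have := isProbabilityMeasure_altLaw hβ0 r n
    exact minTotalError_le_one _ _

/-- Below the boundary every test with vanishing level has vanishing power. -/
theorem tendsto_altLaw_of_lt_rhoStar {β r : ℝ} (hβ : 1 / 2 < β) (hβ' : β < 1) (hr0 : 0 < r)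
    (hr : r < rhoStar β) {A : (n : ℕ) → Set (Fin n → ℝ)}
    (hA : Tendsto (fun n => (nullLaw n).real (A n)) atTop (𝓝 0)) :
    Tendsto (fun n => (altLaw β r n).real (A n)) atTop (𝓝 0) := by
  have hm : Tendsto (fun n => minTotalError (nullLaw n) (altLaw β r n)) atTop (𝓝 1) :=
    merge_of_lt_rhoStar hβ hβ' hr0 hr
  have hlim : Tendsto (fun n => (nullLaw n).real (A n) +
      (1 - minTotalError (nullLaw n) (altLaw β r n))) atTop (𝓝 0) := by
    simpa using hA.add (hm.const_sub 1)
  refine squeeze_zero (fun n => measureReal_nonneg) (fun n => ?_) hlim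
  have := isProbabilityMeasure_altLaw (show 0 < β by linarith) r n
  exact measureReal_le_of_minTotalError _ _ _

end Boundary

/-! ### The `p`-values are uniform under the null. -/

section PValues

lemma exp2_real_Ioi {x : ℝ} (hx : 0 ≤ x) : exp2.real (Set.Ioi x) = Real.exp (-x / 2) := by
  have h := probReal_compl_eq_one_sub (μ := exp2) (measurableSet_Iic (a := x))
  have hc := cdf_expMeasure_eq (r := 1 / 2) (by norm_num) x
  have : cdf (expMeasure (1 / 2)) x = exp2.real (Set.Iic x) :=
    cdf_eq_real exp2 x
  rw [Set.compl_Iic] at h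
  rw [h, ← this, hc, if_pos hx]
  have : -(1 / 2 * x) = -x / 2 := by ring
  rw [this]; ring

lemma pValue_of_nonneg {x : ℝ} (hx : 0 ≤ x) : pValue x = Real.exp (-x / 2) := exp2_real_Ioi hx

lemma antitone_pValue : Antitone pValue := fun _ _ h =>
  measureReal_mono (Set.Ioi_subset_Ioi h)

lemma pValue_le_one (x : ℝ) : pValue x ≤ 1 := measureReal_le_one

lemma pValue_of_nonpos {x : ℝ} (hx : x ≤ 0) : pValue x = 1 := by
  refine le_antisymm (pValue_le_one x) ?_
  have := antitone_pValue hx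
  rwa [pValue_of_nonneg le_rfl, neg_zero, zero_div, Real.exp_zero] at this

lemma pValue_pos (x : ℝ) : 0 < pValue x := by
  rcases le_total 0 x with h | h
  · rw [pValue_of_nonneg h]; positivity
  · rw [pValue_of_nonpos h]; exact one_pos

lemma measurable_pValue : Measurable pValue := antitone_pValue.measurable

lemma pValue_le_iff {s x : ℝ} (hs : 0 < s) (hs1 : s < 1) :
    pValue x ≤ s ↔ -2 * Real.log s ≤ x := by
  have hl : Real.log s < 0 := Real.log_neg hs hs1
  rcases le_total 0 x with h | h
  · rw [pValue_of_nonneg h, ← Real.le_log_iff_exp_le hs]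
    constructor <;> intro h <;> linarith
  · rw [pValue_of_nonpos h]
    constructor <;> intro h' <;> linarith

lemma exp2_real_pValue_le {s : ℝ} (hs : 0 ≤ s) (hs1 : s ≤ 1) :
    exp2.real {x | pValue x ≤ s} = s := by
  rcases hs1.eq_or_lt with rfl | hs1
  · simp [pValue_le_one]
  rcases hs.eq_or_lt with rfl | hs
  · have : {x | pValue x ≤ 0} = ∅ := by
      ext x; simp [pValue_pos x]
    simp [this]
  have hl : Real.log s < 0 := Real.log_neg hs hs1
  have h1 : {x | pValue x ≤ s} = Set.Ici (-2 * Real.log s) := by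
    ext x; simp [pValue_le_iff hs hs1]
  rw [h1]
  have h2 : exp2.real (Set.Ici (-2 * Real.log s)) = exp2.real (Set.Ioi (-2 * Real.log s)) := by
    have : NullSingletonClass exp2 := by
      unfold exp2 expMeasure gammaMeasure; infer_instance
    exact measureReal_congr Ioi_ae_eq_Ici.symm
  rw [h2, exp2_real_Ioi (by linarith)]
  rw [show -(-2 * Real.log s) / 2 = Real.log s by ring, Real.exp_log hs]

end PValues

/-! ### Order statistics, counts and boundary crossings. -/

section Counting

variable {n : ℕ}

/-- The number of entries of `p` that are at most `s`. -/
noncomputable def countLE (p : Fin n → ℝ) (s : ℝ) : ℕ :=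
  (Finset.univ.filter fun j => p j ≤ s).card

lemma countLE_mono (p : Fin n → ℝ) : Monotone (countLE p) := fun _ _ h =>
  Finset.card_le_card (Finset.monotone_filter_right _ fun _ _ hj => le_trans hj h)

lemma orderStat_mono (p : Fin n → ℝ) : Monotone (orderStat p) := Tuple.monotone_sort p

lemma succ_le_countLE_orderStat (p : Fin n → ℝ) (i : Fin n) :
    (i : ℕ) + 1 ≤ countLE p (orderStat p i) := by
  have h : ((Finset.Iic i).map (Tuple.sort p).toEmbedding).card ≤
      countLE p (orderStat p i) := by
    refine Finset.card_le_card fun j hj => ?_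
    simp only [Finset.mem_map, Finset.mem_Iic, Equiv.toEmbedding_apply] at hj
    obtain ⟨k, hk, rfl⟩ := hj
    exact Finset.mem_filter.2 ⟨Finset.mem_univ _, orderStat_mono p hk⟩
  simpa using h

lemma orderStat_le_of_lt_countLE (p : Fin n → ℝ) (i : Fin n) {t : ℝ}
    (h : (i : ℕ) < countLE p t) : orderStat p i ≤ t := by
  by_contra hlt
  push Not at hlt
  have hsub : (Finset.univ.filter fun j => p j ≤ t) ⊆
      (Finset.Iio i).map (Tuple.sort p).toEmbedding := by
    intro j hj
    simp only [Finset.mem_filter, Finset.mem_univ, true_and] at hj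
    simp only [Finset.mem_map, Finset.mem_Iio, Equiv.toEmbedding_apply]
    refine ⟨(Tuple.sort p).symm j, ?_, by simp⟩
    by_contra hge
    push Not at hge
    have := orderStat_mono p hge
    simp only [orderStat, Equiv.apply_symm_apply] at this
    unfold orderStat at hlt
    linarith
  have := Finset.card_le_card hsub
  simp only [Finset.card_map, Fin.card_Iio] at this
  unfold countLE at h
  omega

/-- The standardized excess over `t` decreases in the smaller `p`-value. -/
lemma excess_le_excess {c s t : ℝ} (hs : 0 < s) (hst : s ≤ t) (ht : t ≤ 1 / 2) (htc : t ≤ c) :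
    (c - t) / √(t * (1 - t)) ≤ (c - s) / √(s * (1 - s)) := by
  have h1 : 0 < s * (1 - s) := by nlinarith
  have h2 : s * (1 - s) ≤ t * (1 - t) := by nlinarith
  have h3 : 0 < √(s * (1 - s)) := Real.sqrt_pos.2 h1
  have h4 : √(s * (1 - s)) ≤ √(t * (1 - t)) := Real.sqrt_le_sqrt h2
  gcongr
  linarith

/-- A large count of small `p`-values at one level makes higher criticism reject. -/
lemma lt_hcStat_of_countLE {α₀ t h : ℝ} {p : Fin n → ℝ} (hp : ∀ i, 0 < p i)
    (ht : t ≤ 1 / 2) (hN0 : 0 < countLE p t) (hN : (countLE p t : ℝ) ≤ α₀ * n)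
    (htN : t ≤ countLE p t / n)
    (hh : h < √(n : ℝ) * (countLE p t / n - t) / √(t * (1 - t))) :
    h < hcStat α₀ p := by
  have hNn : countLE p t ≤ n := by
    simpa [countLE] using Finset.card_filter_le (Finset.univ : Finset (Fin n)) (fun j => p j ≤ t)
  -- Indices start at `0`, so this is the position of the largest `p`-value that is at most `t`.
  let i : Fin n := ⟨countLE p t - 1, by omega⟩
  have hi1 : ((i : ℕ) : ℝ) + 1 = countLE p t := by
    have : (i : ℕ) + 1 = countLE p t := by simp [i]; omega
    exact_mod_cast this
  have hit : orderStat p i ≤ t := orderStat_le_of_lt_countLE p i (by simp [i]; omega)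
  refine hh.trans_le ?_
  have hb := le_ciSup (f := fun i : {i : Fin n // ((i : ℕ) : ℝ) + 1 ≤ α₀ * n} =>
    √(n : ℝ) * ((((i : Fin n) : ℕ) + 1 : ℝ) / n - orderStat p i) /
      √(orderStat p i * (1 - orderStat p i))) (Set.finite_range _).bddAbove
      ⟨i, by rw [hi1]; exact hN⟩
  refine le_trans ?_ hb
  simp only [hi1]
  rw [mul_div_assoc, mul_div_assoc]
  refine mul_le_mul_of_nonneg_left ?_ (Real.sqrt_nonneg _)
  exact excess_le_excess (hp _) hit ht htN

/-- If higher criticism rejects, then the counting function of the `p`-values crosses the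
boundary `n s + h √(n s (1 - s))`. -/
lemma exists_crossing_of_lt_hcStat {α₀ h : ℝ} {p : Fin n → ℝ} (hp : ∀ i, 0 < p i)
    (hp1 : ∀ i, p i ≤ 1) (h0 : 0 ≤ h) (hh : h < hcStat α₀ p) :
    ∃ s, 0 < s ∧ s < α₀ ∧ 0 < countLE p s ∧
      n * s + h * √(n * s * (1 - s)) ≤ countLE p s := by
  have hex : ∃ i : {i : Fin n // ((i : ℕ) : ℝ) + 1 ≤ α₀ * n},
      h < √(n : ℝ) * ((((i : Fin n) : ℕ) + 1 : ℝ) / n - orderStat p i) /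
      √(orderStat p i * (1 - orderStat p i)) := by
    by_contra hne
    push Not at hne
    rcases isEmpty_or_nonempty {i : Fin n // ((i : ℕ) : ℝ) + 1 ≤ α₀ * n} with he | he
    -- A supremum over no indices is `0` by convention, which cannot exceed `h ≥ 0`.
    · unfold hcStat at hh
      rw [Real.iSup_of_isEmpty] at hh
      linarith
    · exact absurd (ciSup_le hne) (not_le.2 hh)
  obtain ⟨⟨i, hi⟩, hlt⟩ := hex
  simp only at hlt
  set s := orderStat p i with hs
  have hn : 0 < (n : ℝ) := by
    have := i.pos; exact_mod_cast this
  have hs0 : 0 < s := hp _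
  have hs1 : s ≤ 1 := hp1 _
  have hcount := succ_le_countLE_orderStat p i
  have hcount' : ((i : ℕ) : ℝ) + 1 ≤ countLE p s := by exact_mod_cast hcount
  have hpos : 0 < √(n : ℝ) * ((((i : ℕ) : ℝ) + 1) / n - s) / √(s * (1 - s)) := h0.trans_lt hlt
  -- At `s = 1` the quotient is a division by zero, with value `0`, and does not exceed `h`.
  have hv : 0 < √(s * (1 - s)) := by
    rcases (Real.sqrt_nonneg (s * (1 - s))).eq_or_lt with hz | hz
    · rw [← hz, div_zero] at hpos; exact absurd hpos (lt_irrefl 0)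
    · exact hz
  have hnum : 0 < √(n : ℝ) * ((((i : ℕ) : ℝ) + 1) / n - s) := by
    have := mul_pos hpos hv
    rwa [div_mul_cancel₀ _ hv.ne'] at this
  have hsn : 0 < √(n : ℝ) := Real.sqrt_pos.2 hn
  have hdiff : 0 < (((i : ℕ) : ℝ) + 1) / n - s := (pos_iff_pos_of_mul_pos hnum).1 hsn
  refine ⟨s, hs0, ?_, by rw [hs]; omega, ?_⟩
  · have : (((i : ℕ) : ℝ) + 1) / n ≤ α₀ := by rw [div_le_iff₀ hn]; exact hi
    linarith
  · rw [lt_div_iff₀ hv] at hlt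
    have h1 : √(n * s * (1 - s)) = √(n : ℝ) * √(s * (1 - s)) := by
      rw [mul_assoc, Real.sqrt_mul hn.le]
    have h2 : √(n : ℝ) * √(n : ℝ) = n := Real.mul_self_sqrt hn.le
    have h3 : n * ((((i : ℕ) : ℝ) + 1) / n - s) = (i : ℕ) + 1 - n * s := by
      field_simp
    have h4 : √(n : ℝ) * (h * √(s * (1 - s))) ≤
        √(n : ℝ) * (√(n : ℝ) * ((((i : ℕ) : ℝ) + 1) / n - s)) := by gcongr
    rw [← mul_assoc √(n : ℝ) √(n : ℝ), h2, h3] at h4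
    rw [h1]
    linarith

end Counting

/-! ### Power of higher criticism through the count at one level. -/

section Power

lemma countLE_eq_sum {n : ℕ} (x : Fin n → ℝ) (t : ℝ) :
    (countLE (fun i => pValue (x i)) t : ℝ) =
      ∑ i, Set.indicator {y | pValue y ≤ t} (fun _ => (1 : ℝ)) (x i) := by
  simp [countLE, Set.indicator_apply]

lemma measurableSet_pValue_le (t : ℝ) : MeasurableSet {y | pValue y ≤ t} :=
  measurableSet_le measurable_pValue measurable_const

/-- Chebyshev's inequality for the number of small `p`-values. -/
lemma countLE_chebyshev {n : ℕ} (M : Measure ℝ) [IsProbabilityMeasure M] (t : ℝ) {c : ℝ}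
    (hc : 0 < c) :
    (Measure.pi fun _ : Fin n => M).real
      {x | c ≤ |(countLE (fun i => pValue (x i)) t : ℝ) - n * M.real {y | pValue y ≤ t}|} ≤
    n * M.real {y | pValue y ≤ t} / c ^ 2 := by
  set B := {y | pValue y ≤ t}
  have hB : MeasurableSet B := measurableSet_pValue_le t
  set X : ℝ → ℝ := B.indicator fun _ => (1 : ℝ)
  have hX : MemLp X 2 M := memLp_indicator_const 2 hB 1 (Or.inr (measure_ne_top _ _))
  have hXi : ∫ y, X y ∂M = M.real B := by
    simp [X, integral_indicator_const _ hB]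
  set Mn := Measure.pi fun _ : Fin n => M
  have hXn : ∀ i : Fin n, MemLp (fun x : Fin n → ℝ => X (x i)) 2 Mn := fun i =>
    hX.comp_measurePreserving (measurePreserving_eval (fun _ : Fin n => M) i)
  have hS : MemLp (∑ i, fun x : Fin n → ℝ => X (x i)) 2 Mn := memLp_finsetSum' _ fun i _ => hXn i
  have hE : ∫ x, (∑ i, fun x : Fin n → ℝ => X (x i)) x ∂Mn = n * M.real B := by
    simp only [Finset.sum_apply]
    rw [integral_finsetSum _ fun i _ => (hXn i).integrable (by norm_num)]
    have : ∀ i : Fin n, ∫ x, X (x i) ∂Mn = M.real B := fun i => by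
      rw [← hXi]
      exact integral_comp_eval (μ := fun _ : Fin n => M) hX.aestronglyMeasurable
    simp [this]
  have hV : Var[∑ i, fun x : Fin n → ℝ => X (x i); Mn] ≤ n * M.real B := by
    rw [variance_sum_pi (X := fun _ : Fin n => X) fun _ => hX]
    have h1 : Var[X; M] ≤ M.real B := by
      refine (variance_le_expectation_sq hX.aestronglyMeasurable).trans (le_of_eq ?_)
      rw [← hXi]
      congr 1; ext y
      by_cases hy : y ∈ B <;> simp [X, hy]
    simp only [Finset.sum_const, Finset.card_univ, Fintype.card_fin, nsmul_eq_mul]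
    gcongr
  have hch := meas_ge_le_variance_div_sq hS hc
  rw [hE] at hch
  have hset : {x : Fin n → ℝ |
      c ≤ |(countLE (fun i => pValue (x i)) t : ℝ) - n * M.real B|} =
      {x | c ≤ |(∑ i, fun x : Fin n → ℝ => X (x i)) x - n * M.real B|} := by
    ext x
    simp only [Set.mem_ofPred_eq, countLE_eq_sum, Finset.sum_apply, X, B]
  rw [hset, Measure.real]
  refine (ENNReal.toReal_mono ENNReal.ofReal_ne_top hch).trans ?_
  rw [ENNReal.toReal_ofReal (div_nonneg (variance_nonneg _ _) (sq_nonneg _))]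
  gcongr

/-- Lower bound of the probability that higher criticism rejects, when the `p`-value of one
observation is at most `t` with probability `t + D / n`. -/
lemma one_sub_le_hcReject {n : ℕ} (hn : 0 < n) (M : Measure ℝ) [IsProbabilityMeasure M]
    {α₀ t h D : ℝ} (ht0 : 0 < t) (ht : t ≤ 1 / 2) (hD0 : 0 < D)
    (hD : n * M.real {y | pValue y ≤ t} = n * t + D) (hh0 : 0 ≤ h)
    (hh : h * √(n * t) ≤ D / 2) (hα : n * t + 3 / 2 * D ≤ α₀ * n) :
    1 - 4 * (n * t + D) / D ^ 2 ≤ (Measure.pi fun _ : Fin n => M).real (hcReject α₀ n h) := by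
  have hn0 : (0 : ℝ) < n := by exact_mod_cast hn
  set Mn := Measure.pi fun _ : Fin n => M
  -- Half of the excess `D` is given up to fluctuations; the other half must cover the critical
  -- value, as `hh` requires.
  have hch := countLE_chebyshev (n := n) M t (half_pos hD0)
  rw [hD] at hch
  set A := {x : Fin n → ℝ | D / 2 ≤ |(countLE (fun i => pValue (x i)) t : ℝ) - (n * t + D)|}
    with hAdef
  have hA : MeasurableSet A := by
    have hm : Measurable fun x : Fin n → ℝ => (countLE (fun i => pValue (x i)) t : ℝ) := by
      simp_rw [countLE_eq_sum]
      exact Finset.measurable_fun_sum _ fun i _ =>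
        (measurable_const.indicator (measurableSet_pValue_le t)).comp (measurable_pi_apply i)
    exact measurableSet_le measurable_const ((hm.sub_const _).abs)
  have hsub : Aᶜ ⊆ hcReject α₀ n h := by
    intro x hx
    simp only [hAdef, Set.mem_compl_iff, Set.mem_ofPred_eq, not_le, abs_lt] at hx
    set N := countLE (fun i => pValue (x i)) t with hN
    have hnt : 0 < n * t := by positivity
    have hN1 : n * t + D / 2 < N := by linarith
    have hN0 : 0 < N := by
      have : (0 : ℝ) < N := by linarith
      exact_mod_cast this
    refine lt_hcStat_of_countLE (fun i => pValue_pos _) ht hN0 (by linarith) ?_ ?_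
    · rw [le_div_iff₀ hn0]; linarith
    · have hv : 0 < √(t * (1 - t)) := Real.sqrt_pos.2 (by nlinarith)
      rw [lt_div_iff₀ hv, ← hN]
      have hsn : 0 < √(n : ℝ) := Real.sqrt_pos.2 hn0
      have hss : √(n : ℝ) * √(n : ℝ) = n := Real.mul_self_sqrt hn0.le
      have h1 : √(n : ℝ) * √(t * (1 - t)) ≤ √(n * t) := by
        rw [← Real.sqrt_mul hn0.le]
        exact Real.sqrt_le_sqrt (by nlinarith)
      have h2 : h * (√(n : ℝ) * √(t * (1 - t))) ≤ h * √(n * t) := by gcongr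
      have h3 : √(n : ℝ) * (√(n : ℝ) * ((N : ℝ) / n - t)) = N - n * t := by
        rw [← mul_assoc, hss]; field_simp
      refine lt_of_mul_lt_mul_left ?_ hsn.le
      rw [h3]
      linarith
  have h1 := probReal_compl_eq_one_sub (μ := Mn) hA
  have h2 : Mn.real Aᶜ ≤ Mn.real (hcReject α₀ n h) := measureReal_mono hsub
  have h3 : (n * t + D) / (D / 2) ^ 2 = 4 * (n * t + D) / D ^ 2 := by
    field_simp; norm_num
  rw [h3] at hch
  linarith

lemma mixture_real_pValue_le {ε δ t : ℝ} (hε0 : 0 ≤ ε) (hε1 : ε ≤ 1) (ht0 : 0 ≤ t)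
    (ht1 : t ≤ 1) : (mixture ε δ).real {y | pValue y ≤ t} =
      (1 - ε) * t + ε * (noncentralChiSq2 δ).real {y | pValue y ≤ t} := by
  have h := exp2_real_pValue_le ht0 ht1
  unfold mixture
  have hf : ∀ (c : ℝ) (μ : Measure ℝ) [IsProbabilityMeasure μ] (s : Set ℝ),
      (ENNReal.ofReal c • μ) s ≠ ⊤ := fun c μ _ s => by
    rw [Measure.smul_apply, smul_eq_mul]
    exact ENNReal.mul_ne_top ENNReal.ofReal_ne_top (measure_ne_top _ _)
  rw [measureReal_add_apply (hf _ _ _) (hf _ _ _), measureReal_ennreal_smul_apply,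
    measureReal_ennreal_smul_apply, h, ENNReal.toReal_ofReal (by linarith),
    ENNReal.toReal_ofReal hε0]

/-- As `Y² + Z² ≥ Y²`, the event `Y > √(qℓ)` already forces a small `p`-value. With `ℓ = 2 log n`
the level is `n^(-q)`. -/
lemma le_noncentralChiSq2_real {δ q ℓ c : ℝ} (hq : 0 < q) (hℓ : 0 < ℓ) (hc : 0 ≤ c)
    (hcq : √(q * ℓ) - √δ ≤ c) :
    (√(2 * Real.pi))⁻¹ * Real.exp (-(c + 1) ^ 2 / 2) ≤
      (noncentralChiSq2 δ).real {y | pValue y ≤ Real.exp (-(q * ℓ / 2))} := by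
  refine (le_gaussianReal_real_Ioi hc).trans ?_
  refine (measureReal_mono (Set.Ioi_subset_Ioi hcq)).trans ?_
  rw [← gaussianReal_real_Ioi_eq, ← gaussPair_real_fst, noncentralChiSq2_eq,
    map_measureReal_apply measurable_sqNorm (measurableSet_pValue_le _)]
  refine measureReal_mono fun z hz => ?_
  have hz' : √(q * ℓ) < z.1 := hz
  have hqℓ : 0 < q * ℓ := by positivity
  simp only [Set.mem_preimage, Set.mem_ofPred_eq]
  rw [pValue_le_iff (Real.exp_pos _) (by rw [Real.exp_lt_one_iff]; linarith), Real.log_exp]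
  have h1 := (Real.sqrt_lt' ((Real.sqrt_nonneg _).trans_lt hz')).1 hz'
  nlinarith [sq_nonneg z.2]

/-- At level `n^(-q)` the excess count is about `n^(1 - β - c²)` and the null standard deviation
about `n^((1 - q)/2)`; the last expression is the difference of the exponents. The best choice is `q
= min (4r) 1`, with `c` the positive part of `√q - √r`. -/
lemma exists_detection_exponents {β r : ℝ} (hβ' : β < 1) (hr0 : 0 < r)
    (hr : rhoStar β < r) :
    ∃ q c : ℝ, 0 < q ∧ q ≤ 1 ∧ 0 ≤ c ∧ √q - √r ≤ c ∧ 0 < 1 / 2 - β - c ^ 2 + q / 2 := by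
  have hrs := Real.sq_sqrt hr0.le
  have hr' := Real.sqrt_nonneg r
  rcases le_or_gt r (1 / 4) with h4 | h4
  · refine ⟨4 * r, √r, by linarith, by linarith, hr', ?_, ?_⟩
    · have : √(4 * r) = 2 * √r := by
        rw [Real.sqrt_mul (by norm_num), show (4 : ℝ) = 2 ^ 2 by norm_num,
          Real.sqrt_sq (by norm_num)]
      linarith
    · unfold rhoStar at hr
      split_ifs at hr with h
      · linarith
      · exfalso
        push Not at h
        have : √(1 - β) < 1 / 2 := by
          rw [Real.sqrt_lt' (by norm_num)]; linarith
        nlinarith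
  · have h2 : 1 / 2 < √r := by
      rw [Real.lt_sqrt (by norm_num)]; linarith
    rcases le_total 1 √r with h1 | h1
    · exact ⟨1, 0, one_pos, le_rfl, le_rfl, by simpa using h1, by linarith⟩
    · refine ⟨1, 1 - √r, one_pos, le_rfl, by linarith, by simp, ?_⟩
      unfold rhoStar at hr
      split_ifs at hr with h
      · nlinarith
      · have hs := Real.sq_sqrt (show 0 ≤ 1 - β by linarith)
        have hs0 := Real.sqrt_pos.2 (show 0 < 1 - β by linarith)
        have hlt : 1 - √(1 - β) < √r := by
          refine lt_of_pow_lt_pow_left₀ 2 hr' ?_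
          rw [hrs]; exact hr
        nlinarith

end Power

/-! ### Full power above the boundary. -/

section PowerAsymptotics

lemma tendsto_log_natCast : Tendsto (fun n : ℕ => Real.log n) atTop atTop :=
  Real.tendsto_log_atTop.comp tendsto_natCast_atTop_atTop

lemma tendsto_loglog_natCast : Tendsto (fun n : ℕ => Real.log (Real.log n)) atTop atTop :=
  Real.tendsto_log_atTop.comp tendsto_log_natCast

lemma eventually_natCast_rpow_le {a c : ℝ} (ha : a < 0) (hc : 0 < c) :
    ∀ᶠ n : ℕ in atTop, (n : ℝ) ^ a ≤ c :=
  (tendsto_natCast_rpow_zero ha).eventually_le_const hc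

lemma eventually_criticalValue_le {h : ℕ → ℝ} {e : ℝ} (he : 0 < e)
    (hh : Tendsto (fun n : ℕ => h n / √(2 * Real.log (Real.log n))) atTop (𝓝 1)) :
    ∀ᶠ n in atTop, 0 < h n ∧ h n ≤ (n : ℝ) ^ e / 4 := by
  have hlog : ∀ᶠ n : ℕ in atTop, ‖Real.log n‖ ≤ 1 / 128 * ‖(n : ℝ) ^ (2 * e)‖ :=
    tendsto_natCast_atTop_atTop.eventually
      ((isLittleO_log_rpow_atTop (show 0 < 2 * e by linarith)).def (by norm_num))
  filter_upwards [hh.eventually (Ioo_mem_nhds (show (0 : ℝ) < 1 by norm_num) one_lt_two),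
    tendsto_loglog_natCast.eventually_gt_atTop 0, tendsto_log_natCast.eventually_gt_atTop 0,
    hlog, eventually_gt_atTop 0] with n h1 h2 h3 h4 hn
  have hn0 : (0 : ℝ) < n := by exact_mod_cast hn
  have hs : 0 < √(2 * Real.log (Real.log n)) := Real.sqrt_pos.2 (by linarith)
  have hpos : 0 < (n : ℝ) ^ e := by positivity
  constructor
  · have := mul_pos h1.1 hs
    rwa [div_mul_cancel₀ _ hs.ne'] at this
  · have h5 : h n < 2 * √(2 * Real.log (Real.log n)) := (div_lt_iff₀ hs).1 h1.2
    have h6 : √(2 * Real.log (Real.log n)) ≤ (n : ℝ) ^ e / 8 := by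
      refine Real.sqrt_le_iff.2 ⟨by positivity, ?_⟩
      have h7 : Real.log (Real.log n) ≤ Real.log n := Real.log_le_self h3.le
      rw [Real.norm_of_nonneg h3.le, Real.norm_of_nonneg (by positivity)] at h4
      have h8 : (n : ℝ) ^ (2 * e) = ((n : ℝ) ^ e) ^ 2 := by
        rw [mul_comm, Real.rpow_mul hn0.le]; norm_cast
      rw [h8] at h4
      nlinarith
    linarith

/-- The added `1` and the constant factor cost only `exp (O(√(log n)))`, which `n^(-η)` absorbs. -/
lemma eventually_rpow_le_gaussianTail {c η : ℝ} (hη : 0 < η) :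
    ∀ᶠ n : ℕ in atTop, (n : ℝ) ^ (-(c ^ 2) - η) ≤
      (√(2 * Real.pi))⁻¹ * Real.exp (-(c * √(2 * Real.log n) + 1) ^ 2 / 2) := by
  have hT : Tendsto (fun n : ℕ => √(2 * Real.log n)) atTop atTop :=
    Real.tendsto_sqrt_atTop.comp (tendsto_log_natCast.const_mul_atTop two_pos)
  have h1 : Tendsto (fun T : ℝ => T * (η / 2 * T - c)) atTop atTop :=
    tendsto_id.atTop_mul_atTop₀
      (tendsto_atTop_add_const_right _ (-c) (tendsto_id.const_mul_atTop (half_pos hη)))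
  filter_upwards [(h1.comp hT).eventually_ge_atTop (1 / 2 + Real.log √(2 * Real.pi)),
    eventually_gt_atTop 0] with n hn hn0
  have hn0 : (0 : ℝ) < n := by exact_mod_cast hn0
  have hL : 0 ≤ Real.log n := Real.log_natCast_nonneg n
  have hpi : 0 < √(2 * Real.pi) := Real.sqrt_pos.2 (by positivity)
  have hsq := Real.sq_sqrt (show 0 ≤ 2 * Real.log n by positivity)
  simp only [Function.comp] at hn
  set T := √(2 * Real.log n)
  rw [Real.rpow_def_of_pos hn0, ← Real.exp_log (inv_pos.2 hpi), ← Real.exp_add, Real.exp_le_exp,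
    Real.log_inv]
  have : Real.log n = T ^ 2 / 2 := by linarith
  rw [this]
  nlinarith

/-- The error splits into `(√m / D)²` and `1 / D`; the excess `D` beats both `√m` and `1` by a power
of `x`. -/
lemma chebyshev_error_le {x m D e : ℝ} (hx : 0 < x) (hm : 0 ≤ m) (hD : 0 < D)
    (h1 : √m * (x ^ e / 2) ≤ D) (h2 : x ^ e / 2 ≤ D) :
    4 * (m + D) / D ^ 2 ≤ 16 * x ^ (-(2 * e)) + 8 * x ^ (-e) := by
  have hxe : 0 < x ^ e := by positivity
  have h3 : 4 * (m + D) / D ^ 2 = 4 * (√m / D) ^ 2 + 4 / D := by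
    rw [div_pow, Real.sq_sqrt hm]; field_simp
  have h4 : √m / D ≤ 2 * (x ^ e)⁻¹ := by
    rw [div_le_iff₀ hD]
    calc √m = 2 * (x ^ e)⁻¹ * (√m * (x ^ e / 2)) := by field_simp
      _ ≤ _ := by gcongr
  have h5 : 4 / D ≤ 8 * (x ^ e)⁻¹ := by
    rw [div_le_iff₀ hD]
    calc (4 : ℝ) = 8 * (x ^ e)⁻¹ * (x ^ e / 2) := by field_simp; norm_num
      _ ≤ _ := by gcongr
  have h6 : x ^ (-(2 * e)) = ((x ^ e)⁻¹) ^ 2 := by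
    rw [← Real.rpow_neg hx.le, ← Real.rpow_natCast (x ^ (-e)), ← Real.rpow_mul hx.le]
    congr 1; push_cast; ring
  have h7 : (√m / D) ^ 2 ≤ (2 * (x ^ e)⁻¹) ^ 2 := by gcongr
  rw [h3, h6, Real.rpow_neg hx.le]
  linarith

/-- Above the boundary the power of higher criticism tends to one. -/
theorem tendsto_hcReject_of_rhoStar_lt {α₀ β r : ℝ} (hα₀ : 0 < α₀) (hβ : 1 / 2 < β)
    (hβ' : β < 1) (hr0 : 0 < r) (hr : rhoStar β < r) {h : ℕ → ℝ}
    (hh : Tendsto (fun n : ℕ => h n / √(2 * Real.log (Real.log n))) atTop (𝓝 1)) :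
    Tendsto (fun n => (altLaw β r n).real (hcReject α₀ n (h n))) atTop (𝓝 1) := by
  obtain ⟨q, c, hq0, hq1, hc0, hcq, he⟩ := exists_detection_exponents hβ' hr0 hr
  -- Half of the surplus exponent pays for the Gaussian tail estimate; the other half remains as the
  -- factor `n^e` by which the excess count beats `√(n t)`.
  set e := (1 / 2 - β - c ^ 2 + q / 2) / 2 with hedef
  have he0 : 0 < e := half_pos he
  have hβ0 : 0 < β := by linarith
  have hlim : Tendsto (fun n : ℕ => 1 - (16 * (n : ℝ) ^ (-(2 * e)) + 8 * (n : ℝ) ^ (-e)))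
      atTop (𝓝 1) := by
    have := (((tendsto_natCast_rpow_zero (show -(2 * e) < 0 by linarith)).const_mul 16).add
      ((tendsto_natCast_rpow_zero (show -e < 0 by linarith)).const_mul 8)).const_sub 1
    simpa using this
  refine tendsto_of_tendsto_of_tendsto_of_le_of_le' hlim tendsto_const_nhds ?_
    (Eventually.of_forall fun n => ?_)
  · filter_upwards [eventually_criticalValue_le he0 hh,
      eventually_rpow_le_gaussianTail (c := c) he0,
      eventually_natCast_rpow_le (show -(q - c ^ 2 - e) < 0 by linarith)
        (show (0 : ℝ) < 1 / 2 by norm_num),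
      eventually_natCast_rpow_le (show -q < 0 by linarith)
        (show (0 : ℝ) < min (1 / 2) (α₀ / 4) by positivity),
      eventually_natCast_rpow_le (show -β < 0 by linarith)
        (show (0 : ℝ) < α₀ / 2 by positivity),
      eventually_gt_atTop 1] with n hhn htail hts ht hε hn1
    have hn0 : (0 : ℝ) < n := by positivity
    have hL : 0 < Real.log n := Real.log_pos (by exact_mod_cast hn1)
    have hprob := isProbabilityMeasure_mixture hβ0 (2 * r * Real.log n) n
    set ε := (n : ℝ) ^ (-β) with hεdef
    set t := (n : ℝ) ^ (-q) with htdef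
    have hε0 : 0 < ε := by positivity
    have ht0 : 0 < t := by positivity
    have hε1 : ε ≤ 1 := rpow_neg_le_one hβ0 n
    have ht2 : t ≤ 1 / 2 := ht.trans (min_le_left _ _)
    have ht4 : t ≤ α₀ / 4 := ht.trans (min_le_right _ _)
    set S := (noncentralChiSq2 (2 * r * Real.log n)).real {y | pValue y ≤ t} with hS
    have hS1 : S ≤ 1 := measureReal_le_one
    have hte : t = Real.exp (-(q * (2 * Real.log n) / 2)) := by
      rw [htdef, Real.rpow_def_of_pos hn0]; congr 1; ring
    have hSge : (n : ℝ) ^ (-(c ^ 2) - e) ≤ S := by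
      refine htail.trans ?_
      rw [hS, hte]
      refine le_noncentralChiSq2_real hq0 (by positivity) (by positivity) ?_
      rw [Real.sqrt_mul hq0.le, show 2 * r * Real.log n = r * (2 * Real.log n) by ring,
        Real.sqrt_mul hr0.le, ← sub_mul]
      gcongr
    -- Then the null contribution `t` takes at most half of `S`, so `S - t` keeps its order.
    have htS : t ≤ 1 / 2 * (n : ℝ) ^ (-(c ^ 2) - e) := by
      calc t = (n : ℝ) ^ (-(q - c ^ 2 - e)) * (n : ℝ) ^ (-(c ^ 2) - e) := by
            rw [← Real.rpow_add hn0, htdef]; congr 1; ring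
        _ ≤ _ := by gcongr
    set D := n * (ε * (S - t)) with hDdef
    have hDge : √(n * t) * ((n : ℝ) ^ e / 2) ≤ D := by
      have h1 : √(n * t) = (n : ℝ) ^ ((1 - q) / 2) := by
        have h2 : n * t = ((n : ℝ) ^ ((1 - q) / 2)) ^ 2 := by
          rw [htdef, ← Real.rpow_natCast, ← Real.rpow_mul hn0.le]
          nth_rewrite 1 [← Real.rpow_one (n : ℝ)]
          rw [← Real.rpow_add hn0]; congr 1; push_cast; ring
        rw [h2, Real.sqrt_sq (by positivity)]
      calc √(n * t) * ((n : ℝ) ^ e / 2) = n * (ε * (1 / 2 * (n : ℝ) ^ (-(c ^ 2) - e))) := by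
            have h3 : (n : ℝ) * (ε * (n : ℝ) ^ (-(c ^ 2) - e)) =
                (n : ℝ) ^ ((1 - q) / 2) * (n : ℝ) ^ e := by
              rw [hεdef, ← Real.rpow_add hn0, ← Real.rpow_add hn0]
              nth_rewrite 1 [← Real.rpow_one (n : ℝ)]
              rw [← Real.rpow_add hn0]; congr 1; rw [hedef]; ring
            rw [h1]; linear_combination -(1 / 2) * h3
        _ ≤ D := by rw [hDdef]; gcongr; linarith
    have hnt1 : 1 ≤ n * t := by
      rw [htdef]
      nth_rewrite 1 [← Real.rpow_one (n : ℝ)]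
      rw [← Real.rpow_add hn0]
      exact Real.one_le_rpow (by exact_mod_cast hn1.le) (by linarith)
    have hsnt1 : 1 ≤ √(n * t) := Real.one_le_sqrt.2 hnt1
    have hne : 0 < (n : ℝ) ^ e := by positivity
    have hD1 : (n : ℝ) ^ e / 2 ≤ D := by
      refine le_trans ?_ hDge
      nlinarith
    have hD0 : 0 < D := by linarith
    have hF : n * (mixture ε (2 * r * Real.log n)).real {y | pValue y ≤ t} = n * t + D := by
      rw [mixture_real_pValue_le hε0.le hε1 ht0.le (by linarith), hDdef]; ring
    have hhD : h n * √(n * t) ≤ D / 2 := by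
      have : h n * √(n * t) ≤ (n : ℝ) ^ e / 4 * √(n * t) := by gcongr; exact hhn.2
      linarith
    have hα : n * t + 3 / 2 * D ≤ α₀ * n := by
      have h1 : D ≤ n * ε := by
        rw [hDdef]; gcongr; exact mul_le_of_le_one_right hε0.le (by linarith)
      have h2 : n * t ≤ n * (α₀ / 4) := by gcongr
      have h3 : n * ε ≤ n * (α₀ / 2) := by gcongr
      linarith
    have hmain := one_sub_le_hcReject (α₀ := α₀) (by omega) (mixture ε (2 * r * Real.log n))
      ht0 ht2 hD0 hF hhn.1.le hhD hα
    refine le_trans ?_ hmain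
    have := chebyshev_error_le hn0 (by positivity) hD0 hDge hD1
    linarith
  · have := isProbabilityMeasure_altLaw hβ0 r n
    exact measureReal_le_one

end PowerAsymptotics

/-! ### A maximal inequality for the uniform empirical process. -/

section MaximalInequality

/-- `U` is the uniform law on `[0, 1]`, described by its distribution function. -/
def IsUniformLaw (U : Measure ℝ) : Prop :=
  ∀ s, 0 ≤ s → s ≤ 1 → U (Set.Iic s) = ENNReal.ofReal s

lemma measurable_countLE {n : ℕ} (s : ℝ) : Measurable fun x : Fin n → ℝ => countLE x s := by
  have h : (fun x : Fin n → ℝ => countLE x s) =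
      fun x => ∑ i, Set.indicator (Set.Iic s) (fun _ => 1) (x i) := by
    ext x; simp [countLE, Set.indicator_apply]
  rw [h]
  exact Finset.measurable_fun_sum _ fun i _ =>
    (measurable_const.indicator measurableSet_Iic).comp (measurable_pi_apply i)

lemma countLE_max {n : ℕ} (x : Fin n → ℝ) {s s' : ℝ} (h : s ≤ s') :
    countLE (fun i => max (x i) s) s' = countLE x s' := by
  simp [countLE, h]

/-- The density with respect to the uniform law of a law with additional mass on `(-∞, t]`. -/
noncomputable def tilt (w : ENNReal) (t : ℝ) (y : ℝ) : ENNReal :=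
  1 + (Set.Iic t).indicator (fun _ => w) y

lemma measurable_tilt (w : ENNReal) (t : ℝ) : Measurable (tilt w t) := by
  have : Measurable ((Set.Iic t).indicator fun _ => w) :=
    measurable_const.indicator measurableSet_Iic
  unfold tilt
  fun_prop

lemma prod_tilt {n : ℕ} (w : ENNReal) (t : ℝ) (x : Fin n → ℝ) :
    ∏ i, tilt w t (x i) = (1 + w) ^ countLE x t := by
  have : ∀ i, tilt w t (x i) = if x i ≤ t then 1 + w else 1 := by
    intro i
    by_cases h : x i ≤ t <;> simp [tilt, h]
  simp [this, Finset.prod_ite, countLE]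

lemma withDensity_tilt_Iic {U : Measure ℝ} (hU : IsUniformLaw U) (w : ENNReal) {t y : ℝ}
    (ht : 0 ≤ t) (hty : t ≤ y) (ht1 : t ≤ 1) :
    U.withDensity (tilt w t) (Set.Iic y) = U (Set.Iic y) + w * ENNReal.ofReal t := by
  have h : tilt w t = (fun _ => 1) + (Set.Iic t).indicator fun _ => w := rfl
  rw [h, withDensity_add_left measurable_const, withDensity_const, one_smul,
    withDensity_indicator measurableSet_Iic, withDensity_const, Measure.add_apply,
    Measure.smul_apply, Measure.restrict_apply measurableSet_Iic,
    Set.inter_eq_self_of_subset_right (Set.Iic_subset_Iic.2 hty), hU t ht ht1, smul_eq_mul]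

lemma withDensity_tilt_univ {U : Measure ℝ} [IsProbabilityMeasure U] (hU : IsUniformLaw U)
    (w : ENNReal) {t : ℝ} (ht : 0 ≤ t) (ht1 : t ≤ 1) :
    U.withDensity (tilt w t) Set.univ = 1 + w * ENNReal.ofReal t := by
  have h : tilt w t = (fun _ => 1) + (Set.Iic t).indicator fun _ => w := rfl
  rw [h, withDensity_add_left measurable_const, withDensity_const, one_smul,
    withDensity_indicator measurableSet_Iic, withDensity_const, Measure.add_apply,
    Measure.smul_apply, Measure.restrict_apply MeasurableSet.univ, Set.univ_inter,
    hU t ht ht1, smul_eq_mul, measure_univ]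

lemma isFiniteMeasure_tilt {U : Measure ℝ} [IsProbabilityMeasure U] (hU : IsUniformLaw U)
    {w : ENNReal} (hw : w ≠ ⊤) {t : ℝ} (ht : 0 ≤ t) (ht1 : t ≤ 1) :
    IsFiniteMeasure (U.withDensity (tilt w t)) := by
  constructor
  rw [withDensity_tilt_univ hU w ht ht1]
  exact ENNReal.add_lt_top.2 ⟨ENNReal.one_lt_top, ENNReal.mul_lt_top hw.lt_top ENNReal.ofReal_lt_top⟩

/-- Collapsing everything below `s` to `s` remembers only the total extra mass there, and `v * a` on
`(-∞, a]` equals `v * a / s` times `s` on `(-∞, s]`. -/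
lemma map_max_tilt {U : Measure ℝ} [IsProbabilityMeasure U] (hU : IsUniformLaw U) {a s v : ℝ}
    (ha : 0 < a) (has : a ≤ s) (hs1 : s ≤ 1) (hv : 0 ≤ v) :
    (U.withDensity (tilt (ENNReal.ofReal v) a)).map (fun y => max y s) =
      (U.withDensity (tilt (ENNReal.ofReal (v * a / s)) s)).map (fun y => max y s) := by
  have hm : Measurable fun y : ℝ => max y s := by fun_prop
  have hs : 0 < s := ha.trans_le has
  have := isFiniteMeasure_tilt hU (w := ENNReal.ofReal v) ENNReal.ofReal_ne_top ha.le
    (has.trans hs1)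
  refine Measure.ext_of_Iic _ _ fun y => ?_
  rw [Measure.map_apply hm measurableSet_Iic, Measure.map_apply hm measurableSet_Iic]
  rcases le_or_gt s y with h | h
  · have : (fun y => max y s) ⁻¹' Set.Iic y = Set.Iic y := by ext x; simp [h]
    rw [this, withDensity_tilt_Iic hU _ ha.le (has.trans h) (has.trans hs1),
      withDensity_tilt_Iic hU _ hs.le h hs1, ← ENNReal.ofReal_mul hv,
      ← ENNReal.ofReal_mul (by positivity), div_mul_cancel₀ _ hs.ne']
  · have : (fun y => max y s) ⁻¹' Set.Iic y = ∅ := by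
      ext x; simp [h]
    simp [this]

/-- This is the reverse martingale property in the form of a change of measure: on events that see
the sample only through `max (x i) s`, the integrand is the likelihood ratio of one tilted law that
does not depend on `s`. -/
lemma lintegral_tilt_eq {n : ℕ} {U : Measure ℝ} [IsProbabilityMeasure U] (hU : IsUniformLaw U)
    {a s v : ℝ} (ha : 0 < a) (has : a ≤ s) (hs1 : s ≤ 1) (hv : 0 ≤ v) {B : Set (Fin n → ℝ)}
    (hB : MeasurableSet B) (hBs : (fun (x : Fin n → ℝ) i => max (x i) s) ⁻¹' B = B) :
    ∫⁻ x in B, (1 + ENNReal.ofReal (v * a / s)) ^ countLE x s ∂(Measure.pi fun _ => U) =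
      (Measure.pi fun _ : Fin n => U.withDensity (tilt (ENNReal.ofReal v) a)) B := by
  have hs : 0 < s := ha.trans_le has
  have hm : Measurable fun y : ℝ => max y s := by fun_prop
  have hmn : Measurable fun (x : Fin n → ℝ) i => max (x i) s := by fun_prop
  have h1 := isFiniteMeasure_tilt hU (w := ENNReal.ofReal v) ENNReal.ofReal_ne_top ha.le
    (has.trans hs1)
  have h2 := isFiniteMeasure_tilt hU (w := ENNReal.ofReal (v * a / s)) ENNReal.ofReal_ne_top hs.le
    hs1
  have hpush : ∀ (Q : Measure ℝ) [IsFiniteMeasure Q], (Measure.pi fun _ : Fin n => Q) B =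
      (Measure.pi fun _ : Fin n => Q.map fun y => max y s) B := by
    intro Q _
    rw [← Measure.pi_map_pi (f := fun _ y => max y s) fun _ => hm.aemeasurable,
      Measure.map_apply hmn hB, hBs]
  rw [hpush, map_max_tilt hU ha has hs1 hv, ← hpush, pi_withDensity U _ (measurable_tilt _ _),
    withDensity_apply _ hB]
  simp_rw [prod_tilt]

/-- The maximal inequality for the reverse exponential martingale of the empirical process,
over finitely many times. -/
lemma maximal_finset {n : ℕ} {U : Measure ℝ} [IsProbabilityMeasure U] (hU : IsUniformLaw U)
    {a v : ℝ} (ha : 0 < a) (ha1 : a ≤ 1) (hv : 0 ≤ v) (c : ENNReal) (T : Finset ℝ)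
    (hT : ∀ s ∈ T, a ≤ s ∧ s ≤ 1) :
    c * (Measure.pi fun _ : Fin n => U)
        {x | ∃ s ∈ T, c ≤ (1 + ENNReal.ofReal (v * a / s)) ^ countLE x s} ≤
      (1 + ENNReal.ofReal v * ENNReal.ofReal a) ^ n := by
  set M : ℝ → (Fin n → ℝ) → ENNReal := fun s x =>
    (1 + ENNReal.ofReal (v * a / s)) ^ countLE x s with hM
  have hMm : ∀ s, Measurable (M s) := fun s =>
    (measurable_from_top (f := fun k : ℕ => (1 + ENNReal.ofReal (v * a / s)) ^ k)).comp
      (measurable_countLE s)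
  -- The event that `s` is the last time in `T` at which the level `c` is reached. It depends only
  -- on counts at times from `s` on, and these events are disjoint for distinct times, so their
  -- tilted masses add up to at most the total mass.
  set B : ℝ → Set (Fin n → ℝ) := fun s =>
    {x | c ≤ M s x ∧ ∀ s' ∈ T, s < s' → M s' x < c} with hBdef
  have hBm : ∀ s, MeasurableSet (B s) := by
    intro s
    have : B s = {x | c ≤ M s x} ∩ ⋂ s' ∈ T, {x | s < s' → M s' x < c} := by
      ext x; simp [hBdef]
    rw [this]
    refine (measurableSet_le measurable_const (hMm s)).inter
      (Finset.measurableSet_biInter _ fun s' _ => ?_)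
    by_cases h : s < s'
    · simpa [h] using measurableSet_lt (hMm s') measurable_const
    · simp [h]
  have hBs : ∀ s, (fun (x : Fin n → ℝ) i => max (x i) s) ⁻¹' B s = B s := by
    intro s
    ext x
    simp only [hBdef, hM, Set.mem_preimage, Set.mem_ofPred_eq, countLE_max x le_rfl]
    refine and_congr_right fun _ => forall₂_congr fun s' _ => ?_
    refine imp_congr_right fun h => ?_
    rw [countLE_max x h.le]
  have hdisj : (T : Set ℝ).PairwiseDisjoint B := by
    intro s hs s' hs' hne
    refine Set.disjoint_left.2 fun x hx hx' => ?_
    rcases lt_or_gt_of_ne hne with h | h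
    · exact absurd (hx.2 s' hs' h) (not_lt.2 hx'.1)
    · exact absurd (hx'.2 s hs h) (not_lt.2 hx.1)
  have hsub : {x | ∃ s ∈ T, c ≤ M s x} ⊆ ⋃ s ∈ T, B s := by
    rintro x ⟨s, hs, hx⟩
    obtain ⟨m, hmm, hmax⟩ := (T.filter fun s => c ≤ M s x).exists_max_image id
      ⟨s, Finset.mem_filter.2 ⟨hs, hx⟩⟩
    rw [Finset.mem_filter] at hmm
    refine Set.mem_biUnion hmm.1 ⟨hmm.2, fun s' hs' hlt => ?_⟩
    by_contra hc
    exact absurd (hmax s' (Finset.mem_filter.2 ⟨hs', not_lt.1 hc⟩)) (not_le.2 hlt)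
  set Un := Measure.pi fun _ : Fin n => U
  set Q := U.withDensity (tilt (ENNReal.ofReal v) a) with hQ
  have hQf : IsFiniteMeasure Q := isFiniteMeasure_tilt hU ENNReal.ofReal_ne_top ha.le ha1
  set Qn := Measure.pi fun _ : Fin n => Q
  calc c * Un {x | ∃ s ∈ T, c ≤ M s x} ≤ c * ∑ s ∈ T, Un (B s) := by
        gcongr
        exact (measure_mono hsub).trans (measure_biUnion_finset_le _ _)
    _ = ∑ s ∈ T, c * Un (B s) := Finset.mul_sum _ _ _
    _ ≤ ∑ s ∈ T, Qn (B s) := by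
        refine Finset.sum_le_sum fun s hs => ?_
        rw [← lintegral_tilt_eq hU ha (hT s hs).1 (hT s hs).2 hv (hBm s) (hBs s),
          ← setLIntegral_const]
        exact setLIntegral_mono (hMm s) fun x hx => hx.1
    _ = Qn (⋃ s ∈ T, B s) := (measure_biUnion_finset hdisj fun s _ => hBm s).symm
    _ ≤ Qn Set.univ := measure_mono (Set.subset_univ _)
    _ = _ := by
        rw [Measure.pi_univ]
        simp [hQ, withDensity_tilt_univ hU _ ha.le ha1]

/-- The maximal inequality for the reverse exponential martingale of the empirical process. -/
lemma maximal_inequality {n : ℕ} {U : Measure ℝ} [IsProbabilityMeasure U] (hU : IsUniformLaw U)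
    {a v c : ℝ} (ha : 0 < a) (ha1 : a ≤ 1) (hv : 0 ≤ v) (hc : 0 < c) :
    (Measure.pi fun _ : Fin n => U).real
        {x | ∃ s, a ≤ s ∧ s < 1 ∧ c < (1 + v * a / s) ^ countLE x s} ≤
      (1 + v * a) ^ n / c := by
  set Un := Measure.pi fun _ : Fin n => U
  set E : Finset ℚ → Set (Fin n → ℝ) := fun T =>
    {x | ∃ q ∈ T, a ≤ (q : ℝ) ∧ (q : ℝ) ≤ 1 ∧ c ≤ (1 + v * a / q) ^ countLE x (q : ℝ)} with hE
  have hsub : {x : Fin n → ℝ | ∃ s, a ≤ s ∧ s < 1 ∧ c < (1 + v * a / s) ^ countLE x s} ⊆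
      ⋃ T, E T := by
    rintro x ⟨s, has, hs1, hx⟩
    have hs : 0 < s := ha.trans_le has
    have hcont : ContinuousAt (fun s' : ℝ => (1 + v * a / s') ^ countLE x s) s := by
      have := hs.ne'
      fun_prop (disch := assumption)
    obtain ⟨l, hl, hls⟩ := (mem_nhdsGE_iff_exists_Ico_subset' hs1).1
      (mem_nhdsWithin_of_mem_nhds (hcont.eventually (lt_mem_nhds hx)))
    -- A rational time slightly to the right keeps the strict inequality: the base is continuous and
    -- the count can only grow.
    obtain ⟨q, hq1, hq2⟩ := exists_rat_btwn (show s < min l 1 from lt_min hl hs1)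
    refine Set.mem_iUnion.2 ⟨{q}, q, Finset.mem_singleton_self q, has.trans hq1.le,
      (hq2.trans_le (min_le_right _ _)).le, ?_⟩
    have h1 : c < (1 + v * a / q) ^ countLE x s := hls ⟨hq1.le, hq2.trans_le (min_le_left _ _)⟩
    refine h1.le.trans (pow_le_pow_right₀ ?_ (countLE_mono x hq1.le))
    have : 0 ≤ v * a / q := div_nonneg (mul_nonneg hv ha.le) (hs.le.trans hq1.le)
    linarith
  have hdir : Directed (· ⊆ ·) E := by
    classical
    intro T T'
    refine ⟨T ∪ T', ?_, ?_⟩ <;> rintro x ⟨q, hq, h⟩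
    · exact ⟨q, Finset.mem_union_left _ hq, h⟩
    · exact ⟨q, Finset.mem_union_right _ hq, h⟩
  have hbound : ∀ T, Un (E T) ≤ ENNReal.ofReal ((1 + v * a) ^ n / c) := by
    classical
    intro T
    have hmax := maximal_finset (n := n) hU ha ha1 hv (ENNReal.ofReal c)
      ((T.image fun q : ℚ => (q : ℝ)).filter fun s => a ≤ s ∧ s ≤ 1)
      (fun s hs => (Finset.mem_filter.1 hs).2)
    rw [← ENNReal.ofReal_mul hv, ← ENNReal.ofReal_one, ← ENNReal.ofReal_add zero_le_one
      (by positivity), ← ENNReal.ofReal_pow (by positivity)] at hmax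
    rw [ENNReal.ofReal_div_of_pos hc, ENNReal.le_div_iff_mul_le (by simp [hc]) (by simp),
      mul_comm]
    refine le_trans ?_ hmax
    gcongr
    rintro x ⟨q, hq, h1, h2, h3⟩
    refine ⟨q, Finset.mem_filter.2 ⟨Finset.mem_image_of_mem _ hq, h1, h2⟩, ?_⟩
    have : 0 ≤ v * a / q := div_nonneg (mul_nonneg hv ha.le) (ha.le.trans h1)
    rw [← ENNReal.ofReal_add zero_le_one this, ← ENNReal.ofReal_pow (by linarith)]
    exact ENNReal.ofReal_le_ofReal h3
  have : Un (⋃ T, E T) ≤ ENNReal.ofReal ((1 + v * a) ^ n / c) := by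
    rw [hdir.measure_iUnion]
    exact iSup_le hbound
  exact ENNReal.toReal_le_of_le_ofReal (by positivity) ((measure_mono hsub).trans this)

end MaximalInequality

/-! ### The level of higher criticism at finite sample size. -/

section NullBound

/-- The event that the counting function crosses the boundary `n s + z √(n s)` for some `s < 1`
between `lo` and `hi`. -/
def crossing (n : ℕ) (z lo hi : ℝ) : Set (Fin n → ℝ) :=
  {x | ∃ s, lo ≤ s ∧ s ≤ hi ∧ s < 1 ∧ n * s + z * √(n * s) ≤ countLE x s}

lemma sub_sq_div_two_lt_log {y : ℝ} (hy : 0 < y) : y - y ^ 2 / 2 < Real.log (1 + y) := by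
  refine lt_of_lt_of_le ?_ (Real.le_log_one_add_of_nonneg hy.le)
  rw [lt_div_iff₀ (by linarith)]
  nlinarith [pow_pos hy 3]

/-- The exponent in the maximal inequality, with `w = √(n s)` and `w₀ = √(n a)`. -/
lemma exponent_le {z w₀ w b : ℝ} (hz : 0 < z) (hw₀ : 0 < w₀) (hw : w₀ ≤ w) (hb : 0 < b)
    (hwb : w ≤ b * w₀) {u y : ℝ} (hu : u = z / (w₀ + z)) (hy : y = u * w₀ ^ 2 / w ^ 2) :
    (1 / b - 1 / 2) * z ^ 2 * (w₀ / (w₀ + z)) ≤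
      (w ^ 2 + z * w) * (y - y ^ 2 / 2) - u * w₀ ^ 2 := by
  have hw0 : 0 < w := hw₀.trans_le hw
  have hu0 : 0 < u := by rw [hu]; positivity
  have huz : u * (w₀ + z) = z := by rw [hu]; field_simp
  have hyw : w ^ 2 * y = u * w₀ ^ 2 := by rw [hy]; field_simp
  have h1 : z * u * w₀ / b ≤ z * w * y := by
    -- The linear gain loses only the factor `w₀ / w ≥ 1 / b` across the block.
    have : z * w * y = z * u * w₀ * (w₀ / w) := by rw [hy]; field_simp
    rw [this, div_eq_mul_one_div]
    gcongr ?_ * ?_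
    rw [div_le_div_iff₀ hb hw0]; linarith
  have h2 : (w ^ 2 + z * w) * (y ^ 2 / 2) ≤ z * w₀ * u / 2 := by
    have e : (w ^ 2 + z * w) * (y ^ 2 / 2) = (1 + z / w) * (w₀ / w) ^ 2 * (u ^ 2 * w₀ ^ 2 / 2) := by
      rw [hy]; field_simp
    have h3 : z / w ≤ z / w₀ := by gcongr
    have h4 : (w₀ / w) ^ 2 ≤ 1 := by
      refine pow_le_one₀ (by positivity) ?_
      rw [div_le_one hw0]; exact hw
    have h5 : (1 + z / w) * (w₀ / w) ^ 2 ≤ (1 + z / w₀) * 1 := by gcongr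
    rw [e]
    calc _ ≤ (1 + z / w₀) * 1 * (u ^ 2 * w₀ ^ 2 / 2) := by gcongr
      _ = u * (w₀ + z) * (u * w₀) / 2 := by field_simp
      _ = _ := by rw [huz]; ring
  have h6 : (1 / b - 1 / 2) * z ^ 2 * (w₀ / (w₀ + z)) = z * u * w₀ / b - z * w₀ * u / 2 := by
    rw [hu]; field_simp
  rw [h6]
  nlinarith

/-- A crossing at `s` forces the exponential martingale above its mean by the factor `exp R`,
uniformly over the block, so the maximal inequality gives `exp (-R)`. -/
lemma crossing_block_le {n : ℕ} (hn : 0 < n) {U : Measure ℝ} [IsProbabilityMeasure U]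
    (hU : IsUniformLaw U) {a z g : ℝ} (ha : 0 < a) (hz : 0 < z) (hg : 1 < g) :
    (Measure.pi fun _ : Fin n => U).real (crossing n z a (a * g ^ 2)) ≤
      Real.exp (-((1 / g ^ 2 - 1 / 2) * z ^ 2 * (√(n * a) / (√(n * a) + z)))) := by
  rcases le_or_gt 1 a with ha1 | ha1
  · have : crossing n z a (a * g ^ 2) = ∅ := by
      ext x
      simp only [crossing, Set.mem_ofPred_eq, Set.mem_empty_iff_false, iff_false]
      rintro ⟨s, h1, _, h3, _⟩
      linarith
    simp only [this, measureReal_empty]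
    positivity
  have hn0 : (0 : ℝ) < n := by exact_mod_cast hn
  have hw₀ : 0 < √(n * a) := Real.sqrt_pos.2 (by positivity)
  set w₀ := √(n * a) with hw₀def
  set R := (1 / g ^ 2 - 1 / 2) * z ^ 2 * (w₀ / (w₀ + z)) with hR
  -- This tilt maximizes the quadratic exponent `(w₀² + z w₀)(u - u²/2) - u w₀²` at the left end of
  -- the block.
  set u := z / (w₀ + z) with hu
  have hu0 : 0 < u := by rw [hu]; positivity
  have hu1 : u < 1 := by rw [hu, div_lt_one (by positivity)]; linarith
  have hua : 0 < 1 + u * a := by positivity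
  have hmax := maximal_inequality (n := n) hU ha ha1.le hu0.le
    (c := (1 + u * a) ^ n * Real.exp R) (by positivity)
  have hval : (1 + u * a) ^ n / ((1 + u * a) ^ n * Real.exp R) = Real.exp (-R) := by
    rw [Real.exp_neg]; field_simp
  rw [hval] at hmax
  refine le_trans (measureReal_mono ?_) hmax
  rintro x ⟨s, has, hsg, hs1, hx⟩
  refine ⟨s, has, hs1, ?_⟩
  have hs0 : 0 < s := ha.trans_le has
  set N : ℝ := (countLE x s : ℝ) with hN
  set w := √(n * s) with hw
  have hw0 : 0 < w := Real.sqrt_pos.2 (by positivity)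
  have hw2 : w ^ 2 = n * s := Real.sq_sqrt (by positivity)
  have hw₀2 : w₀ ^ 2 = n * a := Real.sq_sqrt (by positivity)
  have hww : w₀ ≤ w := Real.sqrt_le_sqrt (by gcongr)
  have hwg : w ≤ g ^ 2 * w₀ := by
    have h1 : w ≤ √(g ^ 2 * (n * a)) := Real.sqrt_le_sqrt (by nlinarith)
    rw [Real.sqrt_mul (by positivity), Real.sqrt_sq (by linarith)] at h1
    nlinarith
  have hy : u * a / s = u * w₀ ^ 2 / w ^ 2 := by rw [hw2, hw₀2]; field_simp
  have hexp := exponent_le hz hw₀ hww (show 0 < g ^ 2 by positivity) hwg hu hy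
  set y := u * a / s with hydef
  have hy0 : 0 < y := by rw [hydef]; positivity
  have hy1 : y < 1 := by
    rw [hydef, div_lt_one hs0]; nlinarith
  have hNpos : 0 < N := lt_of_lt_of_le (by positivity) hx
  have hlog1 : N * (y - y ^ 2 / 2) < N * Real.log (1 + y) := by
    gcongr; exact sub_sq_div_two_lt_log hy0
  have hlog2 : (w ^ 2 + z * w) * (y - y ^ 2 / 2) ≤ N * (y - y ^ 2 / 2) := by
    rw [hw2]
    refine mul_le_mul_of_nonneg_right hx ?_
    nlinarith
  have hlog3 : n * Real.log (1 + u * a) ≤ u * w₀ ^ 2 := by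
    have := Real.log_le_sub_one_of_pos hua
    rw [hw₀2]
    have h2 : n * Real.log (1 + u * a) ≤ n * (u * a) := by gcongr; linarith
    linarith
  rw [← Real.log_lt_log_iff (by positivity) (by positivity), Real.log_mul (by positivity)
    (by positivity), Real.log_pow, Real.log_pow, Real.log_exp]
  linarith

/-- For `w ≥ L z` the exponent is nearly the Gaussian `κ z²`. For smaller `w` it is only linear in
`z w`, and `exp (-x) ≤ 1 / x` leaves a multiple of `1 / w`, which is summable along a geometric
grid. -/
lemma exp_neg_split {κ z w L : ℝ} (hκ : 0 < κ) (hz : 0 < z) (hw : 0 < w) (hL : 0 < L) :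
    Real.exp (-(κ * z ^ 2 * (w / (w + z)))) ≤
      Real.exp (-(κ * z ^ 2 * (L / (L + 1)))) + (L + 1) / (κ * z) * w⁻¹ := by
  rcases le_or_gt (L * z) w with h | h
  · have h1 : L / (L + 1) ≤ w / (w + z) := by
      rw [div_le_div_iff₀ (by positivity) (by positivity)]; nlinarith
    have h2 : Real.exp (-(κ * z ^ 2 * (w / (w + z)))) ≤
        Real.exp (-(κ * z ^ 2 * (L / (L + 1)))) := by gcongr
    have : 0 ≤ (L + 1) / (κ * z) * w⁻¹ := by positivity
    linarith
  · have h1 : κ * z * w / (L + 1) ≤ κ * z ^ 2 * (w / (w + z)) := by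
      have : w / ((L + 1) * z) ≤ w / (w + z) := by gcongr; linarith
      calc κ * z * w / (L + 1) = κ * z ^ 2 * (w / ((L + 1) * z)) := by field_simp
        _ ≤ _ := by gcongr
    have hpos : 0 < κ * z * w / (L + 1) := by positivity
    have h2 : Real.exp (-(κ * z * w / (L + 1))) ≤ (κ * z * w / (L + 1))⁻¹ := by
      rw [Real.exp_neg]
      gcongr
      linarith [Real.add_one_le_exp (κ * z * w / (L + 1))]
    have h3 : Real.exp (-(κ * z ^ 2 * (w / (w + z)))) ≤ Real.exp (-(κ * z * w / (L + 1))) := by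
      gcongr
    have h4 : (κ * z * w / (L + 1))⁻¹ = (L + 1) / (κ * z) * w⁻¹ := by field_simp
    have := Real.exp_pos (-(κ * z ^ 2 * (L / (L + 1))))
    linarith

lemma crossing_subset_union (n : ℕ) (z a g : ℝ) (J : ℕ) :
    crossing n z a (a * g ^ (2 * J)) ⊆ {x | ∃ s, a = s ∧ x ∈ crossing n z s s} ∪
      ⋃ k ∈ Finset.range J, crossing n z (a * g ^ (2 * k)) (a * g ^ (2 * k) * g ^ 2) := by
  rintro x ⟨s, h1, h2, h3, h4⟩
  induction J with
  | zero =>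
    left
    -- With no blocks the interval is the single point `a`; this extra set is what makes the
    -- induction start.
    have : s = a := le_antisymm (by simpa using h2) h1
    subst this
    exact ⟨s, rfl, s, le_rfl, le_rfl, h3, h4⟩
  | succ J ih =>
    rcases le_total s (a * g ^ (2 * J)) with h | h
    · refine (ih h).imp id fun h => ?_
      exact Set.biUnion_subset_biUnion_left (fun k hk => by simp at hk ⊢; omega) h
    · right
      refine Set.mem_biUnion (x := J) (by simp) ⟨s, h, ?_, h3, h4⟩
      calc s ≤ a * g ^ (2 * (J + 1)) := h2
        _ = _ := by ring

/-- On the grid `a g^(2k)` the root `√(n s)` grows by the factor `g`, so the non-Gaussian parts of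
the block bounds form a geometric series and only the Gaussian part is multiplied by `J`. -/
lemma crossing_le {n : ℕ} (hn : 0 < n) {U : Measure ℝ} [IsProbabilityMeasure U]
    (hU : IsUniformLaw U) {a z g L : ℝ} (ha : 0 < a) (hz : 0 < z) (hg : 1 < g)
    (hκ : 0 < 1 / g ^ 2 - 1 / 2) (hL : 0 < L) (J : ℕ) (hJ : 0 < J) :
    (Measure.pi fun _ : Fin n => U).real (crossing n z a (a * g ^ (2 * J))) ≤
      J * Real.exp (-((1 / g ^ 2 - 1 / 2) * z ^ 2 * (L / (L + 1)))) +
        (L + 1) / ((1 / g ^ 2 - 1 / 2) * z) * (√(n * a))⁻¹ * (1 - g⁻¹)⁻¹ := by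
  have hn0 : (0 : ℝ) < n := by exact_mod_cast hn
  have hg0 : 0 < g := by linarith
  set κ := 1 / g ^ 2 - 1 / 2 with hκdef
  have hsub : crossing n z a (a * g ^ (2 * J)) ⊆
      ⋃ k ∈ Finset.range J, crossing n z (a * g ^ (2 * k)) (a * g ^ (2 * k) * g ^ 2) := by
    intro x hx
    rcases crossing_subset_union n z a g J hx with ⟨s, rfl, t, h1, h2, h3, h4⟩ | h
    · refine Set.mem_biUnion (x := 0) (by simpa using hJ) ⟨t, by simpa using h1, ?_, h3, h4⟩
      have : 1 ≤ g ^ 2 := one_le_pow₀ hg.le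
      simp only [mul_zero, pow_zero, mul_one]
      nlinarith
    · exact h
  have hterm : ∀ k : ℕ, (Measure.pi fun _ : Fin n => U).real
      (crossing n z (a * g ^ (2 * k)) (a * g ^ (2 * k) * g ^ 2)) ≤
      Real.exp (-(κ * z ^ 2 * (L / (L + 1)))) +
        (L + 1) / (κ * z) * (√(n * a))⁻¹ * g⁻¹ ^ k := by
    intro k
    have hw : √(n * (a * g ^ (2 * k))) = √(n * a) * g ^ k := by
      rw [← mul_assoc, Real.sqrt_mul (by positivity), mul_comm 2 k, pow_mul,
        Real.sqrt_sq (by positivity)]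
    have hwpos : 0 < √(n * a) * g ^ k := mul_pos (Real.sqrt_pos.2 (by positivity)) (by positivity)
    refine (crossing_block_le hn hU (by positivity) hz hg).trans ?_
    rw [hw]
    refine (exp_neg_split hκ hz hwpos hL).trans (le_of_eq ?_)
    rw [mul_inv, inv_pow, mul_assoc ((L + 1) / (κ * z))]
  refine (measureReal_mono hsub (measure_ne_top _ _)).trans ((measureReal_biUnion_finset_le _ _).trans ?_)
  refine (Finset.sum_le_sum fun k _ => hterm k).trans ?_
  rw [Finset.sum_add_distrib, ← Finset.mul_sum]
  have hgeo : ∑ k ∈ Finset.range J, g⁻¹ ^ k ≤ (1 - g⁻¹)⁻¹ := by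
    have h0 : 0 ≤ g⁻¹ := by positivity
    have h1 : g⁻¹ < 1 := inv_lt_one_of_one_lt₀ hg
    rw [← tsum_geometric_of_lt_one h0 h1]
    exact (summable_geometric_of_lt_one h0 h1).sum_le_tsum _ fun k _ => by positivity
  have hsqrt : 0 ≤ (√(n * a))⁻¹ := by positivity
  simp only [Finset.sum_const, Finset.card_range, nsmul_eq_mul]
  gcongr

lemma countLE_pos_le {n : ℕ} {U : Measure ℝ} [IsProbabilityMeasure U] (hU : IsUniformLaw U)
    {s : ℝ} (hs : 0 ≤ s) (hs1 : s ≤ 1) :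
    (Measure.pi fun _ : Fin n => U).real {x | 0 < countLE x s} ≤ n * s := by
  have hsub : {x : Fin n → ℝ | 0 < countLE x s} ⊆
      ⋃ i ∈ (Finset.univ : Finset (Fin n)), (fun x => x i) ⁻¹' Set.Iic s := by
    intro x hx
    obtain ⟨i, hi⟩ := Finset.card_pos.1 hx
    exact Set.mem_biUnion (Finset.mem_univ i) (by simpa using hi)
  refine (measureReal_mono hsub (measure_ne_top _ _)).trans ((measureReal_biUnion_finset_le _ _).trans (le_of_eq ?_))
  have : ∀ i : Fin n, (Measure.pi fun _ : Fin n => U).real ((fun x => x i) ⁻¹' Set.Iic s) = s := by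
    intro i
    rw [(measurePreserving_eval (fun _ : Fin n => U) i).measureReal_preimage
      measurableSet_Iic.nullMeasurableSet, Measure.real, hU s hs hs1, ENNReal.toReal_ofReal hs]
  simp [this]

lemma isUniformLaw_pValue : IsUniformLaw (exp2.map pValue) := by
  intro s h0 h1
  rw [Measure.map_apply measurable_pValue measurableSet_Iic]
  have h : exp2.real (pValue ⁻¹' Set.Iic s) = s := exp2_real_pValue_le h0 h1
  rw [← ofReal_measureReal, h]

/-- A bound of the level of higher criticism in samples of size `n`. -/
lemma nullLaw_hcReject_le {n : ℕ} (hn : 0 < n) {α₀ h g L τ : ℝ} (hα : α₀ < 1) (hh : 1 ≤ h)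
    (hτ0 : 0 < τ) (hτ1 : τ < 1) (hg : 1 < g) (hκ : 0 < 1 / g ^ 2 - 1 / 2) (hL : 0 < L)
    {J J' : ℕ} (hJ : 0 < J) (hJn : n * h ≤ g ^ (2 * J)) (hJ' : 0 < J')
    (hJτ : 1 ≤ τ * g ^ (2 * J')) :
    (nullLaw n).real (hcReject α₀ n h) ≤ 1 / h +
      (J * Real.exp (-((1 / g ^ 2 - 1 / 2) * (√(1 - τ) * h) ^ 2 * (L / (L + 1)))) +
        (L + 1) / ((1 / g ^ 2 - 1 / 2) * (√(1 - τ) * h)) * √h * (1 - g⁻¹)⁻¹) +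
      (J' * Real.exp (-((1 / g ^ 2 - 1 / 2) * (√(1 - α₀) * h) ^ 2 * (L / (L + 1)))) +
        (L + 1) / ((1 / g ^ 2 - 1 / 2) * (√(1 - α₀) * h)) * (√(n * τ))⁻¹ * (1 - g⁻¹)⁻¹) := by
  have hn0 : (0 : ℝ) < n := by exact_mod_cast hn
  have hn1 : (1 : ℝ) ≤ n := by exact_mod_cast hn
  have hh0 : 0 < h := by linarith
  have hU := isUniformLaw_pValue
  have hUp : IsProbabilityMeasure (exp2.map pValue) :=
    Measure.isProbabilityMeasure_map measurable_pValue.aemeasurable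
  set U := exp2.map pValue
  set Un := Measure.pi fun _ : Fin n => U
  have ha : 0 < 1 / (n * h) := by positivity
  have hτ' : 0 < √(1 - τ) := Real.sqrt_pos.2 (by linarith)
  have hα' : 0 < √(1 - α₀) := Real.sqrt_pos.2 (by linarith)
  -- Below `1 / (n h)` there is likely no `p`-value at all. Up to `τ` many blocks are needed, but
  -- `√(1 - s)` is nearly one; from `τ` to `α₀` boundedly many blocks suffice, so the loss `√(1 -
  -- α₀)` is harmless.
  set A := {x : Fin n → ℝ | 0 < countLE x (1 / (n * h))}
  set B := crossing n (√(1 - τ) * h) (1 / (n * h)) (1 / (n * h) * g ^ (2 * J))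
  set C := crossing n (√(1 - α₀) * h) τ (τ * g ^ (2 * J'))
  have hmap : (nullLaw n).map (fun x i => pValue (x i)) = Un := by
    unfold nullLaw
    exact Measure.pi_map_pi (f := fun _ => pValue) fun _ => measurable_pValue.aemeasurable
  have hmeas : Measurable fun (x : Fin n → ℝ) i => pValue (x i) := by
    have := measurable_pValue
    fun_prop
  have hsub : hcReject α₀ n h ⊆ (fun (x : Fin n → ℝ) i => pValue (x i)) ⁻¹' (A ∪ B ∪ C) := by
    intro x hx
    obtain ⟨s, hs0, hsα, hcount, hcr⟩ := exists_crossing_of_lt_hcStat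
      (fun i => pValue_pos (x i)) (fun i => pValue_le_one (x i)) hh0.le hx
    have hle : ∀ b, b < 1 → s ≤ b → n * s + √(1 - b) * h * √(n * s) ≤
        countLE (fun i => pValue (x i)) s := by
      intro b hb hsb
      refine le_trans ?_ hcr
      have : √(1 - b) * √(n * s) ≤ √(n * s * (1 - s)) := by
        rw [← Real.sqrt_mul (by linarith), mul_comm]
        exact Real.sqrt_le_sqrt (by gcongr)
      have : h * (√(1 - b) * √(n * s)) ≤ h * √(n * s * (1 - s)) := by gcongr
      linarith
    rcases lt_or_ge s (1 / (n * h)) with h1 | h1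
    · exact Or.inl (Or.inl (hcount.trans_le (countLE_mono _ h1.le)))
    · rcases le_total s τ with h2 | h2
      · refine Or.inl (Or.inr ⟨s, h1, ?_, by linarith, hle τ hτ1 h2⟩)
        have : 1 ≤ 1 / (n * h) * g ^ (2 * J) := by
          rw [one_div, inv_mul_eq_div, one_le_div (by positivity)]; exact hJn
        linarith
      · exact Or.inr ⟨s, h2, by linarith, by linarith, hle α₀ hα hsα.le⟩
  have hA : Un.real A ≤ 1 / h := by
    refine (countLE_pos_le hU ha.le ?_).trans (le_of_eq (by field_simp))
    rw [div_le_one (by positivity)]; nlinarith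
  have hB := crossing_le hn hU ha (mul_pos hτ' hh0) hg hκ hL J hJ
  have hC := crossing_le hn hU hτ0 (mul_pos hα' hh0) hg hκ hL J' hJ'
  have hroot : (√(n * (1 / (n * h))))⁻¹ = √h := by
    rw [show (n : ℝ) * (1 / (n * h)) = h⁻¹ by field_simp, Real.sqrt_inv, inv_inv]
  rw [hroot] at hB
  have h1 : (nullLaw n).real (hcReject α₀ n h) ≤ Un.real (A ∪ B ∪ C) := by
    rw [← hmap]
    exact ENNReal.toReal_mono (by rw [hmap]; exact measure_ne_top _ _)
      ((measure_mono hsub).trans (Measure.le_map_apply hmeas.aemeasurable _))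
  have h2 : Un.real (A ∪ B ∪ C) ≤ Un.real A + Un.real B + Un.real C :=
    (measureReal_union_le _ _).trans (by gcongr; exact measureReal_union_le _ _)
  linarith

end NullBound

/-! ### Existence of levels that vanish slowly enough. -/

section SlowLevels

/-- The level of higher criticism vanishes along critical values that exceed
`√(2 log log n)` by a constant factor. -/
theorem tendsto_nullLaw_hcReject {α₀ θ : ℝ} (hα : α₀ < 1) (hθ : 1 < θ) :
    Tendsto (fun n : ℕ => (nullLaw n).real (hcReject α₀ n √(2 * θ * Real.log (Real.log n))))
      atTop (𝓝 0) := by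
  have hθ0 : 0 < θ := by linarith
  -- A choice of the tuning parameters.
  obtain ⟨ζ, hζ, hζ0, hζ1⟩ : ∃ ζ : ℝ, 1 < 2 * θ * ((1 / (1 + ζ) ^ 2 - 1 / 2) * (1 - ζ) *
      (1 / (1 + ζ))) ∧ 0 < ζ ∧ ζ < 1 := by
    have hc : ContinuousAt (fun ζ : ℝ => 2 * θ * ((1 / (1 + ζ) ^ 2 - 1 / 2) * (1 - ζ) *
      (1 / (1 + ζ)))) 0 := by
      fun_prop (disch := norm_num)
    have h1 : ∀ᶠ ζ in 𝓝[>] (0 : ℝ), 1 < 2 * θ * ((1 / (1 + ζ) ^ 2 - 1 / 2) * (1 - ζ) *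
      (1 / (1 + ζ))) := by
      refine mem_nhdsWithin_of_mem_nhds (hc.eventually (lt_mem_nhds ?_))
      norm_num
      linarith
    obtain ⟨ζ, h2, h3⟩ := (h1.and (Ioo_mem_nhdsGT one_pos)).exists
    exact ⟨ζ, h2, h3⟩
  set g := 1 + ζ with hg
  set κ := 1 / g ^ 2 - 1 / 2 with hκdef
  have hg1 : 1 < g := by linarith
  have hκ : 0 < κ := by
    by_contra hneg
    have h1 : 0 ≤ (1 - ζ) * (1 / g) := mul_nonneg (by linarith) (by positivity)
    have h2 : 2 * θ * (κ * (1 - ζ) * (1 / g)) ≤ 0 := by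
      rw [mul_assoc κ]
      exact mul_nonpos_of_nonneg_of_nonpos (by positivity)
        (mul_nonpos_of_nonpos_of_nonneg (not_lt.1 hneg) h1)
    linarith
  set L := 1 / ζ with hL
  have hL0 : 0 < L := by positivity
  have hLL : L / (L + 1) = 1 / g := by rw [hL, hg]; field_simp
  -- The Gaussian part of a block bound is `(log n)^(-γ)`; `γ > 1` beats the number of blocks, which
  -- is of order `log n`.
  set γ := 2 * θ * (κ * (1 - ζ) * (1 / g)) with hγ
  have hlg : 0 < Real.log g := Real.log_pos hg1
  set h : ℕ → ℝ := fun n => √(2 * θ * Real.log (Real.log n)) with hh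
  have hhlim : Tendsto h atTop atTop :=
    Real.tendsto_sqrt_atTop.comp (tendsto_loglog_natCast.const_mul_atTop (by positivity))
  obtain ⟨J', hJ'⟩ := pow_unbounded_of_one_lt (1 / ζ) (one_lt_pow₀ hg1 two_ne_zero)
  have hJ'0 : 0 < J' := by
    rcases Nat.eq_zero_or_pos J' with rfl | h
    · rw [pow_zero, div_lt_one hζ0] at hJ'; linarith
    · exact h
  -- Then `g^J ≥ n`, so `2J` powers of `g` cover `n * h n` as soon as `h n ≤ n`.
  set J : ℕ → ℕ := fun n => ⌈Real.log n / Real.log g⌉₊ with hJ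
  have hα' : 0 < √(1 - α₀) := Real.sqrt_pos.2 (by linarith)
  have hζ' : 0 < √(1 - ζ) := Real.sqrt_pos.2 (by linarith)
  set c₁ := (L + 1) / (κ * √(1 - ζ)) * (1 - g⁻¹)⁻¹ with hc₁
  set c₂ := (L + 1) / (κ * √(1 - α₀)) * (√ζ)⁻¹ * (1 - g⁻¹)⁻¹ with hc₂
  set c₃ := κ * (1 - α₀) * (1 / g) with hc₃
  have hc₃0 : 0 < c₃ := mul_pos (mul_pos hκ (by linarith)) (by positivity)
  have hinv : Tendsto (fun n => (h n)⁻¹) atTop (𝓝 0) := tendsto_inv_atTop_zero.comp hhlim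
  have hginv : 0 < (1 - g⁻¹)⁻¹ := inv_pos.2 (sub_pos.2 (inv_lt_one_of_one_lt₀ hg1))
  -- The terms of the bound.
  have t1 : Tendsto (fun n => 1 / h n) atTop (𝓝 0) := by simpa using hinv
  have t2 : Tendsto (fun n : ℕ => (1 / Real.log g + 1) * (Real.log n) ^ (1 - γ)) atTop (𝓝 0) := by
    have := ((tendsto_rpow_neg_atTop (show 0 < γ - 1 by linarith)).comp
      tendsto_log_natCast).const_mul (1 / Real.log g + 1)
    simpa [Function.comp_def] using this
  have t3 : Tendsto (fun n => c₁ * √((h n)⁻¹)) atTop (𝓝 0) := by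
    simpa using hinv.sqrt.const_mul c₁
  have t4 : Tendsto (fun n => J' * Real.exp (-(c₃ * h n ^ 2))) atTop (𝓝 0) := by
    have h1 : Tendsto (fun n => c₃ * h n ^ 2) atTop atTop :=
      ((tendsto_pow_atTop two_ne_zero).comp hhlim).const_mul_atTop hc₃0
    simpa using (Real.tendsto_exp_neg_atTop_nhds_zero.comp h1).const_mul (J' : ℝ)
  have t5 : Tendsto (fun n => c₂ * (h n)⁻¹) atTop (𝓝 0) := by
    simpa using hinv.const_mul c₂
  have hlim : Tendsto (fun n : ℕ => 1 / h n + ((1 / Real.log g + 1) * (Real.log n) ^ (1 - γ) +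
      c₁ * √((h n)⁻¹)) + (J' * Real.exp (-(c₃ * h n ^ 2)) + c₂ * (h n)⁻¹)) atTop (𝓝 0) := by
    simpa using (t1.add (t2.add t3)).add (t4.add t5)
  refine squeeze_zero' (Eventually.of_forall fun n => measureReal_nonneg) ?_ hlim
  have hhn : ∀ᶠ n : ℕ in atTop, h n ≤ n := by
    have hlog : ∀ᶠ n : ℕ in atTop, ‖Real.log n‖ ≤ 1 / (2 * θ) * ‖(n : ℝ) ^ (2 : ℝ)‖ :=
      tendsto_natCast_atTop_atTop.eventually
        ((isLittleO_log_rpow_atTop (show (0 : ℝ) < 2 by norm_num)).def (by positivity))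
    filter_upwards [hlog, tendsto_log_natCast.eventually_gt_atTop 0] with n h1 h2
    refine Real.sqrt_le_iff.2 ⟨by positivity, ?_⟩
    rw [Real.norm_of_nonneg h2.le, Real.norm_of_nonneg (by positivity), Real.rpow_two] at h1
    have h3 := Real.log_le_self h2.le
    calc 2 * θ * Real.log (Real.log n) ≤ 2 * θ * (1 / (2 * θ) * (n : ℝ) ^ 2) := by
          gcongr; linarith
      _ = (n : ℝ) ^ 2 := by field_simp
  filter_upwards [hhlim.eventually_ge_atTop 1, hhn, tendsto_log_natCast.eventually_ge_atTop 1,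
    tendsto_loglog_natCast.eventually_ge_atTop 0, eventually_gt_atTop 1] with n h1 h2 hl hll hn
  have hn0 : (0 : ℝ) < n := by positivity
  have hh0 : 0 < h n := by linarith
  have hl0 : 0 < Real.log n := by linarith
  have hJ0 : 0 < J n := Nat.ceil_pos.2 (by positivity)
  have hJn : n * h n ≤ g ^ (2 * J n) := by
    have h3 : (n : ℝ) ≤ g ^ J n := by
      rw [← Real.log_le_log_iff hn0 (by positivity), Real.log_pow, ← div_le_iff₀ hlg]
      exact Nat.le_ceil _
    calc n * h n ≤ g ^ J n * g ^ J n := by gcongr; exact h2.trans h3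
      _ = _ := by ring
  have hJτ : 1 ≤ ζ * g ^ (2 * J') := by
    rw [pow_mul, mul_comm, ← div_le_iff₀ hζ0]; exact hJ'.le
  have hmain := nullLaw_hcReject_le (n := n) (by omega) hα h1 hζ0 hζ1 hg1 hκ hL0 hJ0 hJn hJ'0 hJτ
  rw [hLL] at hmain
  have hsq : h n ^ 2 = 2 * θ * Real.log (Real.log n) := Real.sq_sqrt (by positivity)
  have hJle : (J n : ℝ) ≤ (1 / Real.log g + 1) * Real.log n := by
    have := (Nat.ceil_lt_add_one (show 0 ≤ Real.log n / Real.log g by positivity)).le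
    calc (J n : ℝ) ≤ Real.log n / Real.log g + 1 := this
      _ ≤ Real.log n / Real.log g + Real.log n := by gcongr
      _ = _ := by ring
  have e2 : J n * Real.exp (-(κ * (√(1 - ζ) * h n) ^ 2 * (1 / g))) ≤
      (1 / Real.log g + 1) * (Real.log n) ^ (1 - γ) := by
    have : -(κ * (√(1 - ζ) * h n) ^ 2 * (1 / g)) = Real.log (Real.log n) * (-γ) := by
      rw [mul_pow, Real.sq_sqrt (by linarith), hsq, hγ]; ring
    rw [this, ← Real.rpow_def_of_pos hl0, sub_eq_add_neg, Real.rpow_add hl0, Real.rpow_one,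
      ← mul_assoc]
    gcongr
  have e3 : (L + 1) / (κ * (√(1 - ζ) * h n)) * √(h n) * (1 - g⁻¹)⁻¹ = c₁ * √((h n)⁻¹) := by
    have h3 : √(h n) = √((h n)⁻¹) * h n := by
      rw [Real.sqrt_inv, inv_mul_eq_div, Real.div_sqrt]
    rw [h3, hc₁]; field_simp
  have e4 : κ * (√(1 - α₀) * h n) ^ 2 * (1 / g) = c₃ * h n ^ 2 := by
    rw [mul_pow, Real.sq_sqrt (by linarith), hc₃]; ring
  have e5 : (L + 1) / (κ * (√(1 - α₀) * h n)) * (√(n * ζ))⁻¹ * (1 - g⁻¹)⁻¹ ≤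
      c₂ * (h n)⁻¹ := by
    have h3 : √ζ ≤ √(n * ζ) := by
      refine Real.sqrt_le_sqrt (le_mul_of_one_le_left hζ0.le ?_)
      exact_mod_cast hn.le
    have h4 : 0 < √ζ := Real.sqrt_pos.2 hζ0
    calc _ ≤ (L + 1) / (κ * (√(1 - α₀) * h n)) * (√ζ)⁻¹ * (1 - g⁻¹)⁻¹ := by gcongr
      _ = _ := by rw [hc₂]; field_simp
  rw [e3, e4] at hmain
  linarith

/-- There are levels that tend to zero slowly enough. -/
theorem exists_slowLevels {α₀ : ℝ} (hα : α₀ < 1) : ∃ α h : ℕ → ℝ, SlowLevels α₀ α h := by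
  set p : ℝ → ℕ → ℝ := fun η n =>
    (nullLaw n).real (hcReject α₀ n √(2 * (1 + η) * Real.log (Real.log n))) with hp
  -- A diagonal argument: `η` is both the inflation of the critical value and the level. A
  -- near-minimal `η n` tends to zero because each fixed `η > 0` is eventually admissible, and `1`
  -- is always admissible.
  set S : ℕ → Set ℝ := fun n => {η | 0 < η ∧ p η n ≤ η} with hS
  have hne : ∀ n, (S n).Nonempty := fun n => ⟨1, one_pos, measureReal_le_one⟩
  have hbdd : ∀ n, BddBelow (S n) := fun n => ⟨0, fun η hη => hη.1.le⟩
  have hex : ∀ n : ℕ, ∃ η ∈ S n, η < sInf (S n) + 1 / ((n : ℝ) + 1) := fun n =>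
    exists_lt_of_csInf_lt (hne n) (lt_add_of_pos_right _ (by positivity))
  choose η hη hηlt using hex
  have hlim : Tendsto η atTop (𝓝 0) := by
    rw [Metric.tendsto_atTop']
    intro e he
    have h1 : ∀ᶠ n in atTop, p (e / 2) n ≤ e / 2 :=
      (tendsto_nullLaw_hcReject hα (show 1 < 1 + e / 2 by linarith)).eventually_le_const
        (half_pos he)
    have h2 : ∀ᶠ n : ℕ in atTop, 1 / ((n : ℝ) + 1) < e / 2 :=
      tendsto_one_div_add_atTop_nhds_zero_nat.eventually_lt_const (half_pos he)
    obtain ⟨N, hN⟩ := eventually_atTop.1 (h1.and h2)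
    refine ⟨N, fun n hn => ?_⟩
    obtain ⟨h3, h4⟩ := hN n hn.le
    have h5 : sInf (S n) ≤ e / 2 := csInf_le (hbdd n) ⟨half_pos he, h3⟩
    rw [Real.dist_eq, sub_zero, abs_of_pos (hη n).1]
    linarith [hηlt n]
  refine ⟨η, fun n => √(2 * (1 + η n) * Real.log (Real.log n)),
    Eventually.of_forall fun n => (hη n).2, hlim, ?_⟩
  have h1 : Tendsto (fun n => √(1 + η n)) atTop (𝓝 1) := by
    simpa using (hlim.const_add 1).sqrt
  refine h1.congr' ?_
  filter_upwards [tendsto_loglog_natCast.eventually_gt_atTop 0] with n hn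
  have h2 : 0 < √(2 * Real.log (Real.log n)) := Real.sqrt_pos.2 (by positivity)
  rw [eq_div_iff h2.ne', ← Real.sqrt_mul (by linarith [(hη n).1])]
  congr 1; ring

end SlowLevels

/-! ### Both boundaries and their uniqueness. -/

section MainResults

theorem isHCDetectionBoundary_rhoStar {α₀ β : ℝ} (hα₀ : 0 < α₀) (hβ : 1 / 2 < β) (hβ' : β < 1) :
    IsHCDetectionBoundary α₀ β (rhoStar β) := fun _ _ hs _ hr0 =>
  ⟨fun hr => tendsto_hcReject_of_rhoStar_lt hα₀ hβ hβ' hr0 hr hs.slow,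
    fun hr => tendsto_altLaw_of_lt_rhoStar hβ hβ' hr0 hr
      (squeeze_zero' (Eventually.of_forall fun _ => measureReal_nonneg) hs.level hs.tendsto_zero)⟩

/-- Above the boundary higher criticism separates the hypotheses. -/
theorem separate_of_rhoStar_lt {β r : ℝ} (hβ : 1 / 2 < β) (hβ' : β < 1) (hr0 : 0 < r)
    (hr : rhoStar β < r) : Separate β r := by
  -- Separation does not involve `α₀`, so any value in `(0, 1)` would do.
  obtain ⟨α, h, hs⟩ := exists_slowLevels (show (1 / 2 : ℝ) < 1 by norm_num)
  have h1 := tendsto_hcReject_of_rhoStar_lt (show (0 : ℝ) < 1 / 2 by norm_num) hβ hβ' hr0 hr hs.slow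
  have hlim : Tendsto (fun n => α n + (1 - (altLaw β r n).real (hcReject (1 / 2) n (h n))))
      atTop (𝓝 0) := by
    simpa using hs.tendsto_zero.add (h1.const_sub 1)
  refine squeeze_zero' (Eventually.of_forall fun n => minTotalError_nonneg _ _) ?_ hlim
  filter_upwards [hs.level] with n hn
  have := isProbabilityMeasure_altLaw (show 0 < β by linarith) r n
  have := measureReal_le_of_minTotalError (nullLaw n) (altLaw β r n) (hcReject (1 / 2) n (h n))
  linarith

theorem isIntrinsicDetectionBoundary_rhoStar {β : ℝ} (hβ : 1 / 2 < β) (hβ' : β < 1) :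
    IsIntrinsicDetectionBoundary β (rhoStar β) := fun _ hr0 =>
  ⟨separate_of_rhoStar_lt hβ hβ' hr0, merge_of_lt_rhoStar hβ hβ' hr0⟩

/-- A number is determined by a dichotomy on the positive numbers below and above it. -/
lemma eq_of_dichotomy {ρ ρ' : ℝ} {P Q : ℝ → Prop} (hρ : 0 < ρ) (hPQ : ∀ r, P r → Q r → False)
    (h : ∀ r, 0 < r → (ρ < r → P r) ∧ (r < ρ → Q r))
    (h' : ∀ r, 0 < r → (ρ' < r → P r) ∧ (r < ρ' → Q r)) : ρ' = ρ := by
  rcases lt_trichotomy ρ' ρ with hlt | heq | hlt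
  · obtain ⟨r, h1, h2⟩ := exists_between (max_lt hlt hρ)
    have hr0 : 0 < r := (le_max_right _ _).trans_lt h1
    exact (hPQ r ((h' r hr0).1 ((le_max_left _ _).trans_lt h1)) ((h r hr0).2 h2)).elim
  · exact heq
  · obtain ⟨r, h1, h2⟩ := exists_between hlt
    have hr0 : 0 < r := hρ.trans h1
    exact (hPQ r ((h r hr0).1 h1) ((h' r hr0).2 h2)).elim

end MainResults

end HigherCriticism

theorem theorem1p7 (β : ℝ) (hβ : 1 / 2 < β) (hβ' : β < 1) :
    (∀ α₀ : ℝ, 0 < α₀ → α₀ < 1 →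
      ∀ ρ : ℝ, HigherCriticism.IsHCDetectionBoundary α₀ β ρ ↔ ρ = HigherCriticism.rhoStar β) ∧
    (∀ ρ : ℝ, HigherCriticism.IsIntrinsicDetectionBoundary β ρ ↔
      ρ = HigherCriticism.rhoStar β) := by
  have hρ := HigherCriticism.rhoStar_pos hβ
  refine ⟨fun α₀ hα₀ hα₁ ρ => ⟨fun h => ?_, ?_⟩, fun ρ => ⟨fun h => ?_, ?_⟩⟩
  -- One admissible sequence suffices for uniqueness: the power along it cannot tend to both `0` and
  -- `1`.
  · obtain ⟨α, c, hs⟩ := HigherCriticism.exists_slowLevels hα₁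
    exact HigherCriticism.eq_of_dichotomy hρ
      (fun r h0 h1 => one_ne_zero (tendsto_nhds_unique h0 h1))
      (HigherCriticism.isHCDetectionBoundary_rhoStar hα₀ hβ hβ' α c hs) (h α c hs)
  · rintro rfl
    exact HigherCriticism.isHCDetectionBoundary_rhoStar hα₀ hβ hβ'
  · exact HigherCriticism.eq_of_dichotomy hρ
      (fun r h0 h1 => zero_ne_one (tendsto_nhds_unique h0 h1))
      (HigherCriticism.isIntrinsicDetectionBoundary_rhoStar hβ hβ') h
  · rintro rfl
    exact HigherCriticism.isIntrinsicDetectionBoundary_rhoStar hβ hβ'
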